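/- Let $1\le n\le r$ be integers. Let $\mathcal F_{r,n}\subset\mathbb C^{n\times r}$ be the funtf variety, i.e. the set of complex $n\times r$ matrices $V=(v_{ij})$ with $VV^T=\frac rn\,\mathrm{Id}_n$ and $\sum_{i=1}^n v_{ij}^2=1$ for $j=1,\dots,r$; the real matrices in $\mathcal F_{r,n}$ are the finite unit norm tight frames. Let the Plücker map $\mathbb C^{n\times r}\to\mathbb C^{\binom rn}$ send a matrix $V$ to the vector $p(V)=(p_I)$ of its $n\times n$ minors, where $I$ ranges over the $n$-element subsets of $[r]=\{1,\dots,r\}$, and let $\mathrm{Gr}(n,r)\subset\mathbb C^{\binom rn}$ be the image of the Plücker map. Let $X$ be the image of $\mathcal F_{r,n}$ under the Plücker map. 1. $X$ is a (possibly reducible) affine variety in $\mathbb C^{\binom rn}$, contained in $\mathrm{Gr}(n,r)$. If $r>n$, its dimension is $(r-n)n-r+1$. 2. $X$ is defined inside $\mathrm{Gr}(n,r)$ by the equations $$\sum_{I:\,i\in I}p_I^2=\left(\frac rn\right)^{n-1}\qquad (i=1,\dots,r);$$ that is, $X$ is the set of all $p\in \mathrm{Gr}(n,r)$ that satisfy them.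 3. The real points of $X$ correspond to the $\mathrm{SO}_n$-orbits of real frames in $\mathcal F_{r,n}$: the Plücker map induces a bijection from the set of orbits of the real matrices in $\mathcal F_{r,n}$ under left multiplication by the real rotation group $\mathrm{SO}_n$ onto the set $X\cap\mathbb R^{\binom rn}$. -/

import Mathlib

/-- The index set `binom([r], n)` of the `n`-element subsets of `{1, …, r}`. -/
abbrev PluckerIndex (n r : ℕ) : Type := {I : Finset (Fin r) // I.card = n}

/-- The Plücker map: an `n × r` matrix is sent to the vector of its `n × n` minors, the minor
with index `I` being formed by the columns in `I`, in increasing order. -/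
def pluckerMap {K : Type*} [Field K] {n r : ℕ} (V : Matrix (Fin n) (Fin r) K) :
    PluckerIndex n r → K :=
  fun I => (V.submatrix id (I.1.orderEmbOfFin I.2)).det

/-- The (affine cone over the) Grassmannian `Gr(n, r)`, the image of the Plücker map. -/
def grassmannCone (n r : ℕ) : Set (PluckerIndex n r → ℂ) :=
  Set.range (pluckerMap (K := ℂ) (n := n) (r := r))

/-- The matrices `V` with `V Vᵀ = (r / n) Id` all of whose columns satisfy `∑ vᵢⱼ² = 1`.
For `K = ℂ` this is the funtf variety; for `K = ℝ` these are the finite unit norm tight frames. -/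
def funtf (K : Type*) [Field K] (n r : ℕ) : Set (Matrix (Fin n) (Fin r) K) :=
  {V | V * V.transpose = ((r : K) / (n : K)) • (1 : Matrix (Fin n) (Fin n) K) ∧
    ∀ j : Fin r, ∑ i : Fin n, V i j ^ 2 = 1}

/-- The image of the complex funtf variety under the Plücker map. -/
def funtfPluckerImage (n r : ℕ) : Set (PluckerIndex n r → ℂ) :=
  pluckerMap '' funtf ℂ n r

/-- A subset of `ℂ^σ` is an affine variety (possibly reducible) if it is the common zero set of
an ideal of polynomials. -/
def IsAffineVariety {σ : Type*} (X : Set (σ → ℂ)) : Prop :=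
  ∃ J : Ideal (MvPolynomial σ ℂ), X = MvPolynomial.zeroLocus ℂ J

/-- The dimension of an affine variety: the Krull dimension of its coordinate ring. -/
noncomputable def affineDim {σ : Type*} (X : Set (σ → ℂ)) : WithBot ℕ∞ :=
  ringKrullDim (MvPolynomial σ ℂ ⧸ MvPolynomial.vanishingIdeal ℂ X)

/-- The set of real points of a subset of `ℂ^σ`. -/
def realPoints {σ : Type*} (X : Set (σ → ℂ)) : Set (σ → ℝ) :=
  {q | (fun i => (q i : ℂ)) ∈ X}

/-- Two real funtfs are equivalent if they lie in the same orbit of the rotation group `SO_n`,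
which acts by multiplication from the left. -/
def rotationSetoid (n r : ℕ) : Setoid (funtf ℝ n r) where
  r V W := ∃ g ∈ Matrix.specialOrthogonalGroup (Fin n) ℝ, g * V.1 = W.1
  iseqv :=
    { refl := fun V => ⟨1, one_mem _, Matrix.one_mul _⟩
      symm := by
        rintro V W ⟨g, hg, h⟩
        obtain ⟨ho, hd⟩ := Matrix.mem_specialOrthogonalGroup_iff.1 hg
        have h1 : g.transpose * g = 1 := (Matrix.mem_orthogonalGroup_iff' (Fin n) ℝ).1 ho
        have h2 : g * g.transpose = 1 := (Matrix.mem_orthogonalGroup_iff (Fin n) ℝ).1 ho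
        refine ⟨g.transpose, Matrix.mem_specialOrthogonalGroup_iff.2 ⟨?_, ?_⟩, ?_⟩
        · refine (Matrix.mem_orthogonalGroup_iff (Fin n) ℝ).2 ?_
          show g.transpose * g.transpose.transpose = 1
          rw [Matrix.transpose_transpose, h1]
        · rw [Matrix.det_transpose, hd]
        · rw [← h, ← Matrix.mul_assoc, h1, Matrix.one_mul]
      trans := by
        rintro V W X ⟨g, hg, h⟩ ⟨k, hk, h'⟩
        exact ⟨k * g, mul_mem hk hg, by rw [Matrix.mul_assoc, h, h']⟩ }

/-- The set of `SO_n`-orbits of real funtfs. -/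
abbrev FuntfOrbit (n r : ℕ) : Type := Quotient (rotationSetoid n r)

/-! Let `P = Vᵀ(VVᵀ)⁻¹V` be the projection onto the row space of `V`. Deleting column `j`,
Cauchy–Binet and the matrix determinant lemma show that the sum of `p_I²` over `I ∋ j` is `det(VVᵀ)
P_jj` (`squareSum_maximalMinors`), which gives the equations for a frame. Conversely, summing the
equations over `j` yields `det(VVᵀ) = (r/n)^n`. Factor `(n/r)VVᵀ = AAᵀ` and correct `det A = ±1` by
a reflection; then `A⁻¹V` is tight with the same minors, and the equations force unit columns
(`exists_funtf_of_squareSum`). The factor exists over ℂ because symmetric forms diagonalize and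
square roots exist, over ℝ by positivity, so the same argument describes the real points. Frames
with equal minors differ by `W_I V_I⁻¹`, which is a rotation. Closedness follows because the
Grassmann cone is itself cut out by `pluckerRelation`.

Upper bound for the dimension: at the generic point of an irreducible closed subset, `P` is a
symmetric idempotent with constant diagonal `n/r` over the function field, and the minors are
algebraic over its entries. Derivations send `P` to symmetric matrices `M` with `PM + MP = M` and
zero diagonal. Without the diagonal condition these form a space of dimension at most `n(r-n)`, and
taking diagonals has rank at least `r-1` unless `P` commutes with a nonscalar diagonal matrix. In
that case `P` splits into blocks and induction on the size applies
(`exists_finset_of_constant_diagonal`).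

Lower bound: an affine chart of the cone has dimension `n(r-n)+1` and `X` is cut out there by `r`
equations, so Krull's height theorem applies once a point exists; harmonic frames supply one. -/

open Matrix Equiv

/-! ### Minors, Plücker relations and Cauchy–Binet over a commutative ring -/

section Brackets

variable {R : Type*} [CommRing R] {n r : ℕ}

/-- The increasing enumeration of the elements of an index set. -/
abbrev PluckerIndex.emb (I : PluckerIndex n r) : Fin n ↪o Fin r := I.1.orderEmbOfFin I.2

/-- The maximal minors of a matrix over a commutative ring. -/
def maximalMinors (V : Matrix (Fin n) (Fin r) R) : PluckerIndex n r → R :=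
  fun I => (V.submatrix id I.emb).det

/-- The image of an injective map, as an index set. -/
def PluckerIndex.ofInjective (f : Fin n → Fin r) (hf : Function.Injective f) :
    PluckerIndex n r :=
  ⟨Finset.univ.image f, by rw [Finset.card_image_of_injective _ hf, Finset.card_fin]⟩

theorem PluckerIndex.range_emb (I : PluckerIndex n r) : Set.range I.emb = (I.1 : Set (Fin r)) :=
  Finset.range_orderEmbOfFin _ _

theorem PluckerIndex.emb_mem (I : PluckerIndex n r) (i : Fin n) : I.emb i ∈ I.1 :=
  Finset.orderEmbOfFin_mem _ _ _

theorem PluckerIndex.exists_emb_eq (I : PluckerIndex n r) {j : Fin r} (hj : j ∈ I.1) :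
    ∃ i, I.emb i = j := by
  have : j ∈ Set.range I.emb := by rw [I.range_emb]; exact hj
  exact this

theorem exists_perm_emb_comp (f : Fin n → Fin r) (hf : Function.Injective f) :
    ∃ σ : Perm (Fin n), f = (PluckerIndex.ofInjective f hf).emb ∘ σ := by
  have h : ∀ i, ∃ k, (PluckerIndex.ofInjective f hf).emb k = f i := fun i =>
    PluckerIndex.exists_emb_eq _ (Finset.mem_image_of_mem _ (Finset.mem_univ i))
  choose g hg using h
  have hinj : Function.Injective g := fun a b hab => hf (by rw [← hg a, ← hg b, hab])
  exact ⟨Equiv.ofBijective g (Finite.injective_iff_bijective.1 hinj), funext fun i => (hg i).symm⟩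

/-- The permutation sorting an injective map. -/
noncomputable def sortPerm (f : Fin n → Fin r) (hf : Function.Injective f) : Perm (Fin n) :=
  (exists_perm_emb_comp f hf).choose

theorem emb_comp_sortPerm (f : Fin n → Fin r) (hf : Function.Injective f) :
    (PluckerIndex.ofInjective f hf).emb ∘ sortPerm f hf = f :=
  (exists_perm_emb_comp f hf).choose_spec.symm

open Classical in
/-- The alternating extension of a vector of Plücker coordinates to arbitrary tuples of columns. -/
noncomputable def bracket (p : PluckerIndex n r → R) (f : Fin n → Fin r) : R :=
  if hf : Function.Injective f then
    ((Perm.sign (sortPerm f hf) : ℤ) : R) * p (PluckerIndex.ofInjective f hf)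
  else 0

theorem map_bracket {S : Type*} [CommRing S] (φ : R →+* S) (p : PluckerIndex n r → R)
    (f : Fin n → Fin r) : φ (bracket p f) = bracket (fun I => φ (p I)) f := by
  unfold bracket
  split_ifs <;> simp

theorem bracket_maximalMinors (V : Matrix (Fin n) (Fin r) R) (f : Fin n → Fin r) :
    bracket (maximalMinors V) f = (V.submatrix id f).det := by
  unfold bracket
  split_ifs with hf
  · have h := Matrix.det_permute' (sortPerm f hf)
      (V.submatrix id (PluckerIndex.ofInjective f hf).emb)
    rw [Matrix.submatrix_submatrix, emb_comp_sortPerm] at h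
    exact h.symm
  · obtain ⟨a, b, hab, hne⟩ : ∃ a b, f a = f b ∧ a ≠ b := by
      simpa [Function.Injective] using hf
    exact (Matrix.det_zero_of_column_eq hne fun k => by simp [hab]).symm

/-- The matrix whose row span is encoded by `p`, normalized on the columns in `I`. -/
noncomputable def chartMatrix (p : PluckerIndex n r → R) (I : PluckerIndex n r) :
    Matrix (Fin n) (Fin r) R :=
  Matrix.of fun i j => bracket p (Function.update I.emb i j)

/-- Cramer's rule: exchanging one column of the block `V_I` for column `j` of `V` computes a
coordinate of `adj(V_I) V`. -/
theorem chartMatrix_maximalMinors (V : Matrix (Fin n) (Fin r) R) (I : PluckerIndex n r) :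
    chartMatrix (maximalMinors V) I = (V.submatrix id I.emb).adjugate * V := by
  ext i j
  rw [chartMatrix, Matrix.of_apply, bracket_maximalMinors]
  have h : ((V.submatrix id I.emb).adjugate * V) i j
      = ((V.submatrix id I.emb).adjugate *ᵥ (fun k => V k j)) i := rfl
  rw [h, ← Matrix.cramer_eq_adjugate_mulVec, Matrix.cramer_apply]
  congr 1
  ext a b
  by_cases hb : b = i
  · subst hb; simp
  · simp [hb]

theorem maximalMinors_mul (A : Matrix (Fin n) (Fin n) R) (V : Matrix (Fin n) (Fin r) R) :
    maximalMinors (A * V) = A.det • maximalMinors V := by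
  funext I
  rw [Pi.smul_apply, smul_eq_mul, maximalMinors, maximalMinors, ← Matrix.det_mul]
  rfl

theorem map_maximalMinors {S : Type*} [CommRing S] (φ : R →+* S) (V : Matrix (Fin n) (Fin r) R)
    (I : PluckerIndex n r) : φ (maximalMinors V I) = maximalMinors (V.map φ) I := by
  rw [maximalMinors, RingHom.map_det]; rfl

theorem map_chartMatrix {S : Type*} [CommRing S] (φ : R →+* S) (p : PluckerIndex n r → R)
    (I : PluckerIndex n r) : (chartMatrix p I).map φ = chartMatrix (fun I => φ (p I)) I := by
  ext i j
  exact map_bracket φ p _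

/-- The defining relations of the Grassmannian in its Plücker embedding. -/
noncomputable def pluckerRelation (p : PluckerIndex n r → R) (I J : PluckerIndex n r) : R :=
  maximalMinors (chartMatrix p I) J - p I ^ (n - 1) * p J

theorem map_pluckerRelation {S : Type*} [CommRing S] (φ : R →+* S) (p : PluckerIndex n r → R)
    (I J : PluckerIndex n r) :
    φ (pluckerRelation p I J) = pluckerRelation (fun I => φ (p I)) I J := by
  simp [pluckerRelation, map_maximalMinors, map_chartMatrix]

/-- The exponent in the relation comes from `det(adj V_I) = p_I^(n-1)`. -/
theorem pluckerRelation_maximalMinors (V : Matrix (Fin n) (Fin r) R) (I J : PluckerIndex n r) :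
    pluckerRelation (maximalMinors V) I J = 0 := by
  rw [pluckerRelation, chartMatrix_maximalMinors, maximalMinors_mul, Matrix.det_adjugate,
    Fintype.card_fin, Pi.smul_apply, smul_eq_mul]
  exact sub_self _

/-- The sum of the squares of the coordinates whose index contains `i`. -/
noncomputable def squareSum (p : PluckerIndex n r → R) (i : Fin r) : R :=
  ∑ I : PluckerIndex n r with i ∈ I.1, p I ^ 2

theorem map_squareSum {S : Type*} [CommRing S] (φ : R →+* S) (p : PluckerIndex n r → R)
    (i : Fin r) : φ (squareSum p i) = squareSum (fun I => φ (p I)) i := by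
  simp [squareSum]

theorem sum_squareSum (p : PluckerIndex n r → R) :
    ∑ i, squareSum p i = (n : R) * ∑ I, p I ^ 2 := by
  simp only [squareSum, Finset.sum_filter]
  rw [Finset.sum_comm, Finset.mul_sum]
  refine Finset.sum_congr rfl fun I _ => ?_
  rw [← Finset.sum_filter, Finset.sum_const, nsmul_eq_mul]
  simp [I.2]

theorem PluckerIndex.emb_comp_injective :
    Function.Injective fun x : PluckerIndex n r × Perm (Fin n) => (x.1.emb ∘ x.2 : Fin n → Fin r) := by
  rintro ⟨I, σ⟩ ⟨J, τ⟩ h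
  simp only at h
  have hIJ : I = J := by
    apply Subtype.ext
    apply Finset.coe_injective
    rw [← I.range_emb, ← J.range_emb, ← σ.surjective.range_comp I.emb, h, τ.surjective.range_comp]
  subst hIJ
  congr
  ext1 i
  exact I.emb.injective (congrFun h i)

/-- The Cauchy–Binet formula. -/
theorem det_mul_transpose_eq_sum (A B : Matrix (Fin n) (Fin r) R) :
    (A * Bᵀ).det = ∑ I, maximalMinors A I * maximalMinors B I := by
  -- Multilinearity expands over all column choices `f`. Injective ones are uniquely an increasing
  -- enumeration composed with a permutation; the others repeat a column and contribute zero.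
  have h1 : (A * Bᵀ).det = ∑ f : Fin n → Fin r, (∏ i, B i (f i)) * (A.submatrix id f).det := by
    simp only [Matrix.det_apply', Matrix.mul_apply, Matrix.transpose_apply]
    simp only [Finset.prod_univ_sum, Fintype.piFinset_univ, Finset.mul_sum]
    rw [Finset.sum_comm]
    refine Finset.sum_congr rfl fun f _ => Finset.sum_congr rfl fun σ _ => ?_
    simp only [Finset.prod_mul_distrib, Matrix.submatrix_apply, id]
    ring
  have h2 : ∑ I, maximalMinors A I * maximalMinors B I =
      ∑ x : PluckerIndex n r × Perm (Fin n),
        (∏ i, B i ((x.1.emb ∘ x.2) i)) * (A.submatrix id (x.1.emb ∘ x.2)).det := by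
    rw [Fintype.sum_prod_type]
    refine Finset.sum_congr rfl fun I _ => ?_
    have h3 : ∀ σ : Perm (Fin n), (A.submatrix id (I.emb ∘ σ)).det
        = (Perm.sign σ : ℤ) * maximalMinors A I := fun σ =>
      Matrix.det_permute' σ (A.submatrix id I.emb)
    simp only [h3]
    have h4 : maximalMinors B I = ∑ σ : Perm (Fin n),
        ((Perm.sign σ : ℤ) : R) * ∏ i, B i (I.emb (σ i)) := by
      rw [maximalMinors, ← Matrix.det_transpose, Matrix.det_apply']
      rfl
    rw [h4, Finset.mul_sum]
    refine Finset.sum_congr rfl fun σ _ => ?_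
    simp only [Function.comp]
    ring
  rw [h1, h2]
  symm
  refine Finset.sum_of_injOn _ PluckerIndex.emb_comp_injective.injOn (by simp) ?_ (fun _ _ => rfl)
  intro f _ hf
  have hni : ¬ Function.Injective f := by
    intro hinj
    exact hf ⟨(PluckerIndex.ofInjective f hinj, sortPerm f hinj), by simp,
      emb_comp_sortPerm f hinj⟩
  obtain ⟨a, b, hab, hne⟩ : ∃ a b, f a = f b ∧ a ≠ b := by
    simpa [Function.Injective] using hni
  rw [Matrix.det_zero_of_column_eq hne fun k => by simp [hab], mul_zero]

theorem det_mul_transpose_self (V : Matrix (Fin n) (Fin r) R) :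
    (V * Vᵀ).det = ∑ I, maximalMinors V I ^ 2 := by
  simp only [det_mul_transpose_eq_sum, sq]

theorem mul_det_mul_transpose_self (V : Matrix (Fin n) (Fin r) R) :
    (n : R) * (V * Vᵀ).det = ∑ i, squareSum (maximalMinors V) i := by
  rw [det_mul_transpose_self, sum_squareSum]

theorem exists_det_eq (hn : 1 ≤ n) (t : R) : ∃ A : Matrix (Fin n) (Fin n) R, A.det = t := by
  refine ⟨Matrix.diagonal (Function.update 1 ⟨0, hn⟩ t), ?_⟩
  rw [Matrix.det_diagonal, Finset.prod_update_of_mem (Finset.mem_univ _)]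
  simp

end Brackets

/-! ### Recognizing vectors of minors; square sums via the row-space projection -/

section Field

variable {K : Type*} [Field K] {n r : ℕ}

/-- At a nonzero coordinate `p I`, the relations say that the chart matrix has minors `p` up to the
factor `p I ^ (n - 1)`, which a left multiplication removes. -/
theorem mem_range_maximalMinors_iff (hn : 1 ≤ n) (p : PluckerIndex n r → K) :
    (∃ V, maximalMinors V = p) ↔ ∀ I J, pluckerRelation p I J = 0 := by
  constructor
  · rintro ⟨V, rfl⟩ I J
    exact pluckerRelation_maximalMinors V I J
  · intro h
    by_cases hp : p = 0
    -- This needs `n ≥ 1`: for `n = 0` the only minor is `1`, and the zero vector would not occur.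
    · obtain ⟨A, hA⟩ := exists_det_eq (R := K) hn 0
      refine ⟨A * (0 : Matrix (Fin n) (Fin r) K), ?_⟩
      rw [maximalMinors_mul, hA, zero_smul, hp]
    · obtain ⟨I, hI⟩ := Function.ne_iff.1 hp
      obtain ⟨A, hA⟩ := exists_det_eq hn (p I ^ (n - 1))⁻¹
      refine ⟨A * chartMatrix p I, ?_⟩
      funext J
      have := sub_eq_zero.1 (h I J)
      rw [maximalMinors_mul, hA, Pi.smul_apply, this, smul_eq_mul, inv_mul_cancel_left₀]
      exact pow_ne_zero _ hI

/-- Zeroing column `j` kills the minors that use it and keeps the others. Cauchy–Binet for both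
matrices, with the matrix determinant lemma for the rank-one change `VVᵀ - v_j v_jᵀ`, isolates the
square sum. -/
theorem squareSum_maximalMinors (V : Matrix (Fin n) (Fin r) K) (hV : (V * Vᵀ).det ≠ 0)
    (j : Fin r) :
    squareSum (maximalMinors V) j = (V * Vᵀ).det * (Vᵀ * (V * Vᵀ)⁻¹ * V) j j := by
  set W := V.updateCol j 0 with hW
  have h1 : ∑ I, maximalMinors V I ^ 2 = squareSum (maximalMinors V) j + (W * Wᵀ).det := by
    rw [det_mul_transpose_self, squareSum, ← Finset.sum_filter_add_sum_filter_not Finset.univ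
      (fun I : PluckerIndex n r => j ∈ I.1)]
    congr 1
    rw [Finset.sum_filter]
    refine Finset.sum_congr rfl fun I _ => ?_
    by_cases hj : j ∈ I.1
    · obtain ⟨b, hb⟩ := I.exists_emb_eq hj
      have : maximalMinors W I = 0 := Matrix.det_eq_zero_of_column_eq_zero b fun a => by
        simp [hW, hb]
      rw [this]; simp [hj]
    · have : W.submatrix id I.emb = V.submatrix id I.emb := by
        ext a b
        have : I.emb b ≠ j := fun h => hj (h ▸ I.emb_mem b)
        simp [hW, this]
      rw [if_pos hj, maximalMinors, maximalMinors.eq_def W, this]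
  have h2 : W * Wᵀ = V * Vᵀ + replicateCol Unit (fun i => - V i j) *
      replicateRow Unit (fun i => V i j) := by
    ext a b
    simp only [Matrix.mul_apply, Matrix.add_apply, Matrix.transpose_apply, hW,
      Finset.univ_unique, Finset.sum_singleton, replicateCol_apply, replicateRow_apply]
    have h : ∑ k ∈ Finset.univ.erase j, V.updateCol j 0 a k * V.updateCol j 0 b k =
        ∑ k ∈ Finset.univ.erase j, V a k * V b k :=
      Finset.sum_congr rfl fun k hk => by
        rw [Matrix.updateCol_ne (Finset.ne_of_mem_erase hk),
          Matrix.updateCol_ne (Finset.ne_of_mem_erase hk)]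
    rw [← Finset.add_sum_erase _ (fun k => V.updateCol j 0 a k * V.updateCol j 0 b k)
      (Finset.mem_univ j), h, ← Finset.add_sum_erase _ (fun k => V a k * V b k)
      (Finset.mem_univ j)]
    simp [sub_eq_add_neg]
  have h3 := Matrix.det_add_replicateCol_mul_replicateRow (ι := Unit)
    (Ne.isUnit hV) (fun i => - V i j) (fun i => V i j)
  rw [← det_mul_transpose_self, h2, h3,
    Matrix.det_unique (1 + _ * _ * _ : Matrix Unit Unit K)] at h1
  have h4 : (replicateRow Unit (fun i => V i j) * (V * Vᵀ)⁻¹ *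
      replicateCol Unit (fun i => - V i j)) default default
      = - (Vᵀ * (V * Vᵀ)⁻¹ * V) j j := by
    simp only [Matrix.mul_apply (M := _ * _), replicateCol_apply, mul_neg, Finset.sum_neg_distrib]
    rfl
  rw [Matrix.add_apply, h4, Matrix.one_apply_eq] at h1
  linear_combination -h1

end Field

/-! ### Normalizing a matrix to a frame; uniqueness up to rotation -/

section Frames

variable {K : Type*} [Field K] {n r : ℕ}

theorem frame_bound_ne_zero [CharZero K] (hn : 1 ≤ n) (hr : n ≤ r) : (r : K) / n ≠ 0 :=
  div_ne_zero (by exact_mod_cast (by omega : r ≠ 0)) (by exact_mod_cast (by omega : n ≠ 0))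

theorem det_smul_one_fin (c : K) : (c • (1 : Matrix (Fin n) (Fin n) K)).det = c ^ n := by
  simp

theorem transpose_mul_self_diag (V : Matrix (Fin n) (Fin r) K) (j : Fin r) :
    (Vᵀ * V) j j = ∑ i, V i j ^ 2 := by
  simp [Matrix.mul_apply, sq]

theorem squareSum_of_tight [CharZero K] (hn : 1 ≤ n) (hr : n ≤ r) {V : Matrix (Fin n) (Fin r) K}
    (hV : V * Vᵀ = ((r : K) / n) • (1 : Matrix (Fin n) (Fin n) K)) (j : Fin r) :
    squareSum (maximalMinors V) j = ((r : K) / n) ^ (n - 1) * ∑ i, V i j ^ 2 := by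
  have hc := frame_bound_ne_zero (K := K) hn hr
  have hdet : (V * Vᵀ).det = ((r : K) / n) ^ n := by rw [hV, det_smul_one_fin]
  rw [squareSum_maximalMinors V (by rw [hdet]; exact pow_ne_zero _ hc), hdet, hV]
  have : (((r : K) / n) • (1 : Matrix (Fin n) (Fin n) K))⁻¹ = ((r : K) / n)⁻¹ • 1 := by
    apply Matrix.inv_eq_right_inv
    rw [Matrix.smul_mul, Matrix.mul_smul, smul_smul, mul_inv_cancel₀ hc, one_smul, Matrix.one_mul]
  rw [this, Matrix.mul_smul, Matrix.mul_one, Matrix.smul_mul, Matrix.smul_apply,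
    transpose_mul_self_diag, smul_eq_mul, ← mul_assoc]
  congr 1
  obtain ⟨m, rfl⟩ : ∃ m, n = m + 1 := ⟨n - 1, by omega⟩
  rw [Nat.add_sub_cancel, pow_succ, mul_assoc, mul_inv_cancel₀ hc, mul_one]

theorem squareSum_of_mem_funtf [CharZero K] (hn : 1 ≤ n) (hr : n ≤ r)
    {V : Matrix (Fin n) (Fin r) K} (hV : V ∈ funtf K n r) (j : Fin r) :
    squareSum (maximalMinors V) j = ((r : K) / n) ^ (n - 1) := by
  rw [squareSum_of_tight hn hr hV.1, hV.2, mul_one]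

theorem det_mul_transpose_of_squareSum [CharZero K] (hn : 1 ≤ n) (V : Matrix (Fin n) (Fin r) K)
    (h : ∀ j, squareSum (maximalMinors V) j = ((r : K) / n) ^ (n - 1)) :
    (V * Vᵀ).det = ((r : K) / n) ^ n := by
  have hn0 : (n : K) ≠ 0 := by exact_mod_cast (by omega : n ≠ 0)
  have h1 := mul_det_mul_transpose_self V
  simp only [h, Finset.sum_const, Finset.card_univ, Fintype.card_fin, nsmul_eq_mul] at h1
  apply mul_left_cancel₀ hn0
  rw [h1]
  obtain ⟨m, rfl⟩ : ∃ m, n = m + 1 := ⟨n - 1, by omega⟩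
  rw [Nat.add_sub_cancel, pow_succ]
  field_simp

theorem exists_funtf_of_squareSum [CharZero K] (hn : 1 ≤ n) (hr : n ≤ r)
    (V : Matrix (Fin n) (Fin r) K)
    (h : ∀ j, squareSum (maximalMinors V) j = ((r : K) / n) ^ (n - 1))
    (A : Matrix (Fin n) (Fin n) K) (hA : A * Aᵀ = ((r : K) / n)⁻¹ • (V * Vᵀ)) :
    ∃ W ∈ funtf K n r, maximalMinors W = maximalMinors V := by
  have hc := frame_bound_ne_zero (K := K) hn hr
  have hdet := det_mul_transpose_of_squareSum hn V h
  have hdA : A.det * A.det = 1 := by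
    have := congrArg Matrix.det hA
    rw [Matrix.det_mul, Matrix.det_transpose, Matrix.det_smul, hdet, Fintype.card_fin,
      ← mul_pow, inv_mul_cancel₀ hc, one_pow] at this
    exact this
  -- Since `A.det = ±1`, this is the identity or a reflection; it corrects the sign of the
  -- determinant without changing `A * Aᵀ`.
  set D : Matrix (Fin n) (Fin n) K := Matrix.diagonal (Function.update 1 ⟨0, hn⟩ A.det) with hD
  have hDdet : D.det = A.det := by
    rw [hD, Matrix.det_diagonal, Finset.prod_update_of_mem (Finset.mem_univ _)]
    simp
  have hDD : D * Dᵀ = 1 := by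
    rw [hD, Matrix.diagonal_transpose, Matrix.diagonal_mul_diagonal, ← Matrix.diagonal_one]
    congr 1
    funext i
    by_cases hi : i = ⟨0, hn⟩
    · subst hi; simpa using hdA
    · simp [hi]
  set B := A * D with hB
  have hBdet : B.det = 1 := by rw [hB, Matrix.det_mul, hDdet, hdA]
  have hBB : B * Bᵀ = ((r : K) / n)⁻¹ • (V * Vᵀ) := by
    rw [hB, Matrix.transpose_mul, Matrix.mul_assoc, ← Matrix.mul_assoc D, hDD, Matrix.one_mul, hA]
  have hBu : IsUnit B.det := by rw [hBdet]; exact isUnit_one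
  have hmin : maximalMinors (B⁻¹ * V) = maximalMinors V := by
    rw [maximalMinors_mul, Matrix.det_nonsing_inv, hBdet]; simp
  have htight : (B⁻¹ * V) * (B⁻¹ * V)ᵀ = ((r : K) / n) • (1 : Matrix (Fin n) (Fin n) K) := by
    have hVV : V * Vᵀ = ((r : K) / n) • (B * Bᵀ) := by
      rw [hBB, smul_smul, mul_inv_cancel₀ hc, one_smul]
    rw [Matrix.transpose_mul, Matrix.mul_assoc, ← Matrix.mul_assoc V, hVV, Matrix.smul_mul,
      Matrix.mul_smul, Matrix.mul_assoc B, ← Matrix.transpose_mul, Matrix.nonsing_inv_mul _ hBu,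
      Matrix.transpose_one, Matrix.mul_one, Matrix.nonsing_inv_mul _ hBu]
  refine ⟨B⁻¹ * V, ⟨htight, fun j => ?_⟩, hmin⟩
  -- For a tight matrix the square sums are a fixed nonzero multiple of the column norms, so the
  -- equations force norm one.
  have h1 := squareSum_of_tight hn hr htight j
  rw [hmin, h] at h1
  exact (mul_left_cancel₀ (pow_ne_zero (n - 1) hc) (by rw [← h1, mul_one])).symm

theorem exists_maximalMinors_ne_zero [CharZero K] (hn : 1 ≤ n) (hr : n ≤ r)
    {V : Matrix (Fin n) (Fin r) K} (hV : V ∈ funtf K n r) : ∃ I, maximalMinors V I ≠ 0 := by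
  have hc := frame_bound_ne_zero (K := K) hn hr
  by_contra! h0
  have h1 := det_mul_transpose_self V
  simp only [h0] at h1
  rw [hV.1, det_smul_one_fin] at h1
  exact pow_ne_zero n hc (by simpa using h1)

/-- At a nonzero minor take `g = W_I V_I⁻¹`. Equal minors give equal chart matrices, so `g` carries
`V` to `W`; tightness of both makes `g` orthogonal, and comparing one minor fixes its determinant.
-/
theorem exists_rotation_of_maximalMinors_eq [CharZero K] (hn : 1 ≤ n) (hr : n ≤ r)
    {V W : Matrix (Fin n) (Fin r) K} (hV : V ∈ funtf K n r) (hW : W ∈ funtf K n r)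
    (h : maximalMinors V = maximalMinors W) :
    ∃ g : Matrix (Fin n) (Fin n) K, g * gᵀ = 1 ∧ g.det = 1 ∧ g * V = W := by
  have hc := frame_bound_ne_zero (K := K) hn hr
  obtain ⟨I, hI⟩ := exists_maximalMinors_ne_zero hn hr hV
  set VI := V.submatrix id I.emb
  set WI := W.submatrix id I.emb
  have hWI : WI.det = maximalMinors V I := by rw [h]; rfl
  have h1 : VI.adjugate * V = WI.adjugate * W := by
    rw [← chartMatrix_maximalMinors, ← chartMatrix_maximalMinors, h]
  have hgV : ((WI.det)⁻¹ • (WI * VI.adjugate)) * V = W := by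
    rw [Matrix.smul_mul, Matrix.mul_assoc, h1, ← Matrix.mul_assoc, Matrix.mul_adjugate,
      Matrix.smul_mul, Matrix.one_mul, smul_smul, inv_mul_cancel₀ (hWI ▸ hI), one_smul]
  set g := (WI.det)⁻¹ • (WI * VI.adjugate)
  refine ⟨g, ?_, ?_, hgV⟩
  · have h2 : W * Wᵀ = g * (V * Vᵀ) * gᵀ := by
      rw [← hgV, Matrix.transpose_mul]; simp only [Matrix.mul_assoc]
    rw [hW.1, hV.1, Matrix.mul_smul, Matrix.smul_mul, Matrix.mul_one] at h2
    exact (smul_right_injective _ hc h2).symm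
  · have h2 := congrFun (maximalMinors_mul g V) I
    rw [hgV, ← h, Pi.smul_apply, smul_eq_mul] at h2
    exact mul_right_cancel₀ hI (by rw [← h2, one_mul])

end Frames

/-! ### Factorizations `A Aᵀ` over ℂ and ℝ -/

/-- Over a field with square roots, a symmetric matrix is a product `A Aᵀ`. -/
theorem exists_mul_transpose_eq_of_isSquare {K : Type*} [Field K] [Invertible (2 : K)] {n : ℕ}
    (hK : ∀ x : K, IsSquare x) (S : Matrix (Fin n) (Fin n) K) (hS : Sᵀ = S) :
    ∃ A : Matrix (Fin n) (Fin n) K, A * Aᵀ = S := by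
  set B : LinearMap.BilinForm K (Fin n → K) := Matrix.toBilin' S with hB
  have hsymm : LinearMap.IsSymm B := by
    refine ⟨fun x y => ?_⟩
    rw [RingHom.id_apply]
    simp only [hB, Matrix.toBilin'_apply']
    rw [Matrix.dotProduct_mulVec, ← Matrix.mulVec_transpose, hS, dotProduct_comm]
  obtain ⟨v, hv⟩ := LinearMap.BilinForm.exists_orthogonal_basis hsymm
  have hfr : Module.finrank K (Fin n → K) = n := by simp
  set b := v.reindex (finCongr hfr)
  set P := (Pi.basisFun K (Fin n)).toMatrix b with hP
  have h1 := LinearMap.BilinForm.toMatrix_mul_basis_toMatrix (Pi.basisFun K (Fin n)) b B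
  have h2 : LinearMap.BilinForm.toMatrix (Pi.basisFun K (Fin n)) B = S := by
    rw [LinearMap.BilinForm.toMatrix_basisFun, hB, LinearMap.BilinForm.toMatrix'_toBilin']
  -- Square roots of the values on an orthogonal basis; they may vanish, as `S` may be degenerate.
  choose s hs using fun i => hK (B (b i) (b i))
  have h3 : LinearMap.BilinForm.toMatrix b B = Matrix.diagonal s * Matrix.diagonal s := by
    rw [Matrix.diagonal_mul_diagonal]
    ext i j
    rw [LinearMap.BilinForm.toMatrix_apply]
    by_cases hij : i = j
    · subst hij; rw [Matrix.diagonal_apply_eq, hs]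
    · rw [Matrix.diagonal_apply_ne _ hij]
      simp only [b, Module.Basis.reindex_apply]
      exact hv (fun h => hij (by simpa using h))
  rw [h2, h3, ← hP] at h1
  set Q := b.toMatrix (Pi.basisFun K (Fin n))
  have hPQ : P * Q = 1 := Module.Basis.toMatrix_mul_toMatrix_flip _ _
  refine ⟨Qᵀ * Matrix.diagonal s, ?_⟩
  calc Qᵀ * Matrix.diagonal s * (Qᵀ * Matrix.diagonal s)ᵀ
      = Qᵀ * (Matrix.diagonal s * Matrix.diagonal s) * Q := by
        rw [Matrix.transpose_mul, Matrix.transpose_transpose, Matrix.diagonal_transpose]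
        simp only [Matrix.mul_assoc]
    _ = (P * Q)ᵀ * S * (P * Q) := by
        rw [← h1, Matrix.transpose_mul]; simp only [Matrix.mul_assoc]
    _ = S := by rw [hPQ]; simp

theorem exists_mul_transpose_eq_complex {n : ℕ} (S : Matrix (Fin n) (Fin n) ℂ) (hS : Sᵀ = S) :
    ∃ A : Matrix (Fin n) (Fin n) ℂ, A * Aᵀ = S :=
  exists_mul_transpose_eq_of_isSquare (fun x => IsAlgClosed.exists_eq_mul_self x) S hS

open scoped MatrixOrder in
theorem exists_mul_transpose_eq_real {n r : ℕ} {c : ℝ} (hc : 0 ≤ c)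
    (V : Matrix (Fin n) (Fin r) ℝ) :
    ∃ A : Matrix (Fin n) (Fin n) ℝ, A * Aᵀ = c • (V * Vᵀ) := by
  have h : (c • (V * Vᵀ)).PosSemidef := by
    have := (Matrix.posSemidef_self_mul_conjTranspose V).smul hc
    rwa [Matrix.conjTranspose_eq_transpose_of_trivial] at this
  obtain ⟨B, hB⟩ := CStarAlgebra.nonneg_iff_eq_star_mul_self.1 h.nonneg
  exact ⟨Bᵀ, by rw [Matrix.transpose_transpose, hB,
    Matrix.star_eq_conjTranspose, Matrix.conjTranspose_eq_transpose_of_trivial]⟩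

/-! ### The image: equations, closedness, real points and orbits -/

section Image

variable {n r : ℕ}

theorem mem_funtfPluckerImage_iff (hn : 1 ≤ n) (hr : n ≤ r) (p : PluckerIndex n r → ℂ) :
    p ∈ funtfPluckerImage n r ↔
      p ∈ grassmannCone n r ∧ ∀ i, squareSum p i = ((r : ℂ) / n) ^ (n - 1) := by
  constructor
  · rintro ⟨V, hV, rfl⟩
    exact ⟨⟨V, rfl⟩, squareSum_of_mem_funtf hn hr hV⟩
  · rintro ⟨⟨V, rfl⟩, h⟩
    obtain ⟨A, hA⟩ := exists_mul_transpose_eq_complex (((r : ℂ) / n)⁻¹ • (V * Vᵀ))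
      (by rw [Matrix.transpose_smul, Matrix.transpose_mul, Matrix.transpose_transpose])
    obtain ⟨W, hW, h'⟩ := exists_funtf_of_squareSum hn hr V h A hA
    exact ⟨W, hW, h'⟩

theorem mem_funtfPluckerImage_iff_equations (hn : 1 ≤ n) (hr : n ≤ r)
    (p : PluckerIndex n r → ℂ) :
    p ∈ funtfPluckerImage n r ↔
      (∀ I J, pluckerRelation p I J = 0) ∧ ∀ i, squareSum p i = ((r : ℂ) / n) ^ (n - 1) := by
  rw [mem_funtfPluckerImage_iff hn hr, ← mem_range_maximalMinors_iff hn]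
  rfl

open MvPolynomial in
theorem isAffineVariety_funtfPluckerImage (hn : 1 ≤ n) (hr : n ≤ r) :
    IsAffineVariety (funtfPluckerImage n r) := by
  refine ⟨Ideal.span
    (Set.range (fun x : PluckerIndex n r × PluckerIndex n r =>
      pluckerRelation (X : PluckerIndex n r → MvPolynomial (PluckerIndex n r) ℂ) x.1 x.2) ∪
    Set.range (fun i => squareSum (X : PluckerIndex n r → MvPolynomial (PluckerIndex n r) ℂ) i -
      C (((r : ℂ) / n) ^ (n - 1)))), ?_⟩
  rw [zeroLocus_span]
  ext p
  have h1 : ∀ I J, aeval p (pluckerRelation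
      (X : PluckerIndex n r → MvPolynomial (PluckerIndex n r) ℂ) I J) = pluckerRelation p I J := by
    intro I J
    simpa using map_pluckerRelation (aeval p).toRingHom
      (X : PluckerIndex n r → MvPolynomial (PluckerIndex n r) ℂ) I J
  have h2 : ∀ i, aeval p (squareSum
      (X : PluckerIndex n r → MvPolynomial (PluckerIndex n r) ℂ) i) = squareSum p i := by
    intro i
    simpa using map_squareSum (aeval p).toRingHom
      (X : PluckerIndex n r → MvPolynomial (PluckerIndex n r) ℂ) i
  rw [mem_funtfPluckerImage_iff_equations hn hr]
  simp only [Set.mem_ofPred_eq, Set.mem_union, or_imp, forall_and, Set.forall_mem_range,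
    Prod.forall, h1, map_sub, h2, sub_eq_zero, aeval_C, Algebra.algebraMap_self, RingHom.id_apply]

/-- The equations are defined over ℝ, and the criterion for being a vector of minors holds over
every field. A real point therefore lifts to a real matrix, which a real factor `A` normalizes. -/
theorem mem_realPoints_iff (hn : 1 ≤ n) (hr : n ≤ r) (q : PluckerIndex n r → ℝ) :
    q ∈ realPoints (funtfPluckerImage n r) ↔ ∃ V ∈ funtf ℝ n r, pluckerMap V = q := by
  have key : q ∈ realPoints (funtfPluckerImage n r) ↔
      (∀ I J, pluckerRelation q I J = 0) ∧ ∀ i, squareSum q i = ((r : ℝ) / n) ^ (n - 1) := by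
    refine (mem_funtfPluckerImage_iff_equations hn hr _).trans ?_
    have h1 : ∀ I J, pluckerRelation (fun I => (q I : ℂ)) I J = ((pluckerRelation q I J : ℝ) : ℂ) :=
      fun I J => (map_pluckerRelation Complex.ofRealHom q I J).symm
    have h2 : ∀ i, squareSum (fun I => (q I : ℂ)) i = ((squareSum q i : ℝ) : ℂ) :=
      fun i => (map_squareSum Complex.ofRealHom q i).symm
    have h3 : ((r : ℂ) / n) ^ (n - 1) = (((r : ℝ) / n) ^ (n - 1) : ℝ) := by push_cast; rfl
    simp only [h1, h2, h3, Complex.ofReal_eq_zero, Complex.ofReal_inj]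
  rw [key, ← mem_range_maximalMinors_iff hn]
  constructor
  · rintro ⟨⟨V, rfl⟩, h⟩
    obtain ⟨A, hA⟩ := exists_mul_transpose_eq_real (c := ((r : ℝ) / n)⁻¹) (by positivity) V
    exact exists_funtf_of_squareSum hn hr V h A hA
  · rintro ⟨V, hV, rfl⟩
    exact ⟨⟨V, rfl⟩, squareSum_of_mem_funtf hn hr hV⟩

theorem pluckerMap_eq_iff_rotation (hn : 1 ≤ n) (hr : n ≤ r) (V W : funtf ℝ n r) :
    (rotationSetoid n r) V W ↔ pluckerMap V.1 = pluckerMap W.1 := by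
  constructor
  · rintro ⟨g, hg, h⟩
    rw [← h]
    have := maximalMinors_mul g V.1
    rw [(Matrix.mem_specialOrthogonalGroup_iff.1 hg).2, one_smul] at this
    exact this.symm
  · intro h
    obtain ⟨g, h1, h2, h3⟩ := exists_rotation_of_maximalMinors_eq hn hr V.2 W.2 h
    exact ⟨g, Matrix.mem_specialOrthogonalGroup_iff.2
      ⟨(Matrix.mem_orthogonalGroup_iff (Fin n) ℝ).2 h1, h2⟩, h3⟩

theorem exists_equiv_realPoints (hn : 1 ≤ n) (hr : n ≤ r) :
    ∃ e : FuntfOrbit n r ≃ realPoints (funtfPluckerImage n r),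
      ∀ V : funtf ℝ n r,
        (e (Quotient.mk (rotationSetoid n r) V) : PluckerIndex n r → ℝ) = pluckerMap V.1 := by
  let f : FuntfOrbit n r → realPoints (funtfPluckerImage n r) :=
    Quotient.lift (fun V => ⟨pluckerMap V.1, (mem_realPoints_iff hn hr _).2 ⟨V.1, V.2, rfl⟩⟩)
      fun V W h => Subtype.ext ((pluckerMap_eq_iff_rotation hn hr V W).1 h)
  refine ⟨Equiv.ofBijective f ⟨?_, ?_⟩, fun V => rfl⟩
  · rintro ⟨V⟩ ⟨W⟩ h
    exact Quotient.sound ((pluckerMap_eq_iff_rotation hn hr V W).2 (congrArg Subtype.val h))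
  · rintro ⟨q, hq⟩
    obtain ⟨V, hV, rfl⟩ := (mem_realPoints_iff hn hr q).1 hq
    exact ⟨Quotient.mk _ ⟨V, hV⟩, rfl⟩

end Image

/-! ### Derivations and transcendence degree in characteristic zero -/

section Derivations

open MvPolynomial TensorProduct

variable {k L : Type*} [Field k] [Field L] [Algebra k L]

open scoped IntermediateField.algebraAdjoinAdjoin in
-- Passing to the fraction field is a localization, and the remaining algebraic extension is
-- separable in characteristic zero.
theorem formallyEtale_adjoin_of_isTranscendenceBasis [CharZero k] {ι : Type*} {x : ι → L}
    (hx : IsTranscendenceBasis k x) :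
    Algebra.FormallyEtale (Algebra.adjoin k (Set.range x)) L := by
  have h1 : Algebra.FormallyEtale (Algebra.adjoin k (Set.range x))
      (IntermediateField.adjoin k (Set.range x)) :=
    .of_isLocalization (nonZeroDivisors _)
  have := hx.isAlgebraic_field
  have : CharZero (IntermediateField.adjoin k (Set.range x)) :=
    charZero_of_injective_algebraMap (algebraMap k _).injective
  have h2 : Algebra.FormallyEtale (IntermediateField.adjoin k (Set.range x)) L :=
    Algebra.FormallyEtale.of_isSeparable _ L
  exact .comp _ (IntermediateField.adjoin k (Set.range x)) _

/-- Derivations with prescribed values on a transcendence basis exist. -/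
theorem exists_derivation_of_isTranscendenceBasis [CharZero k] {ι : Type*} {x : ι → L}
    (hx : IsTranscendenceBasis k x) (y : ι → L) :
    ∃ D : Derivation k L L, ∀ i, D (x i) = y i := by
  let : Algebra (MvPolynomial ι k) L := (aeval x).toAlgebra
  let : Algebra (MvPolynomial ι k) (Algebra.adjoin k (Set.range x)) :=
    hx.1.aevalEquiv.toRingHom.toAlgebra
  have : IsScalarTower k (MvPolynomial ι k) L := .of_algHom (aeval x)
  have : IsScalarTower (MvPolynomial ι k) (Algebra.adjoin k (Set.range x)) L :=
    .of_algebraMap_eq fun p => (hx.1.algebraMap_aevalEquiv p).symm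
  have h1 : Algebra.FormallyEtale (MvPolynomial ι k) (Algebra.adjoin k (Set.range x)) :=
    .of_equiv (A := MvPolynomial ι k) (AlgEquiv.ofRingEquiv (f := hx.1.aevalEquiv.toRingEquiv)
      fun p => rfl)
  have h2 := formallyEtale_adjoin_of_isTranscendenceBasis hx
  have h3 : Algebra.FormallyEtale (MvPolynomial ι k) L :=
    .comp _ (Algebra.adjoin k (Set.range x)) _
  let D₀ : Derivation k (MvPolynomial ι k) L := mkDerivation k y
  let f : L ⊗[MvPolynomial ι k] Ω[(MvPolynomial ι k)⁄k] →ₗ[L] L :=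
    D₀.liftKaehlerDifferential.liftBaseChange L
  -- Formal étaleness identifies the differentials of `L` with a base change of those of the
  -- polynomial ring, so `D₀` extends to `L`.
  let e := KaehlerDifferential.tensorKaehlerEquivOfFormallyEtale k (MvPolynomial ι k) L
  refine ⟨(f ∘ₗ e.symm.toLinearMap).compDer (KaehlerDifferential.D k L), fun i => ?_⟩
  have h4 : x i = algebraMap (MvPolynomial ι k) L (X i) := (aeval_X x i).symm
  have h5 := KaehlerDifferential.tensorKaehlerEquivOfFormallyEtale_symm_D_algebraMap k
    (MvPolynomial ι k) L (X i)
  change f (e.symm (KaehlerDifferential.D k L (x i))) = y i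
  rw [h4, h5]
  simp [f, D₀]

theorem derivation_eq_zero_of_adjoin_eq_top {S : Set L}
    (hS : IntermediateField.adjoin k S = ⊤) (D : Derivation k L L) (h : ∀ a ∈ S, D a = 0) :
    D = 0 := by
  ext a
  have ha : a ∈ IntermediateField.adjoin k S := hS ▸ IntermediateField.mem_top
  induction ha using IntermediateField.adjoin_induction with
  | mem a ha => exact h a ha
  | algebraMap a => simp
  | add a b _ _ ha hb => simp_all
  | inv a _ ha => rw [Derivation.leibniz_inv]; simp_all
  | mul a b _ _ ha hb => rw [Derivation.leibniz]; simp_all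

theorem derivation_sum_apply {ι : Type*} (s : Finset ι) (D : ι → Derivation k L L) (a : L) :
    (∑ i ∈ s, D i) a = ∑ i ∈ s, D i a := by
  have := congrFun (map_sum Derivation.coeFnAddMonoidHom D s) a
  rwa [Finset.sum_apply] at this

open scoped IntermediateField.algebraAdjoinAdjoin in
theorem isAlgebraic_adjoin_of_intermediateField_adjoin_eq_top {S : Set L}
    (hS : IntermediateField.adjoin k S = ⊤) : Algebra.IsAlgebraic (Algebra.adjoin k S) L := by
  have h : Algebra.IsAlgebraic (IntermediateField.adjoin k S) L := by
    rw [hS]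
    exact ⟨fun a => isAlgebraic_algebraMap (⟨a, IntermediateField.mem_top⟩ :
      (⊤ : IntermediateField k L))⟩
  exact (IsFractionRing.comap_isAlgebraic_iff (A := Algebra.adjoin k S)
    (K := IntermediateField.adjoin k S) (C := L)).2 h

/-- The transcendence degree is at most the dimension of a space that contains the values of all
derivations on a generating family. -/
theorem exists_finset_of_derivation_mem [CharZero k] {κ : Type*} [Finite κ] (G : κ → L)
    (hG : IntermediateField.adjoin k (Set.range G) = ⊤) (T : Submodule L (κ → L))
    (hT : ∀ D : Derivation k L L, (fun a => D (G a)) ∈ T) :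
    ∃ s : Finset L, s.card ≤ Module.finrank L T ∧
      Algebra.IsAlgebraic (Algebra.adjoin k (s : Set L)) L := by
  classical
  have halg := isAlgebraic_adjoin_of_intermediateField_adjoin_eq_top hG
  obtain ⟨t, htG, ht⟩ := exists_isTranscendenceBasis_subset (R := k) (Set.range G)
  have hfin : t.Finite := (Set.finite_range G).subset htG
  lift t to Finset L using hfin
  refine ⟨t, ?_, by rw [← Subtype.range_coe (s := (t : Set L))]; exact ht.isAlgebraic⟩
  -- Derivations dual to the basis. A linear relation among their values on `G` gives a derivation
  -- killing a generating family, hence zero; evaluating it on the basis kills the coefficients.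
  choose D hD using fun i : t =>
    exists_derivation_of_isTranscendenceBasis ht (fun j => if i = j then (1 : L) else 0)
  have hli : LinearIndependent L (fun i : t => (⟨fun a => D i (G a), hT (D i)⟩ : T)) := by
    rw [Fintype.linearIndependent_iff]
    intro c hc j
    have h0 : ∑ i, c i • D i = 0 := by
      apply derivation_eq_zero_of_adjoin_eq_top hG
      rintro _ ⟨a, rfl⟩
      have := congrFun (congrArg Subtype.val hc) a
      rw [derivation_sum_apply]
      simpa [Finset.sum_apply] using this
    have h1 := congrArg (fun D : Derivation k L L => D (j : L)) h0
    simp only [derivation_sum_apply] at h1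
    simpa [hD] using h1
  simpa using hli.fintype_card_le_finrank

end Derivations

/-! ### Tangent spaces of symmetric idempotent matrices -/

section Projections

variable {F : Type*} [Field F] {ι : Type*} [Fintype ι] [DecidableEq ι]

/-- The tangent space at `P` of the variety of symmetric idempotent matrices. -/
def projTangent (P : Matrix ι ι F) : Submodule F (Matrix ι ι F) where
  carrier := {M | Mᵀ = M ∧ P * M + M * P = M}
  zero_mem' := by simp
  add_mem' := by
    rintro M N ⟨h1, h2⟩ ⟨h3, h4⟩
    refine ⟨by rw [Matrix.transpose_add, h1, h3], ?_⟩
    rw [Matrix.mul_add, Matrix.add_mul, ← add_add_add_comm, h2, h4]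
  smul_mem' := by
    rintro a M ⟨h1, h2⟩
    refine ⟨by rw [Matrix.transpose_smul, h1], ?_⟩
    rw [Matrix.mul_smul, Matrix.smul_mul, ← smul_add, h2]

/-- The map `N ↦ (1 - P) N P`. -/
def offDiagonalBlock (P : Matrix ι ι F) : Matrix ι ι F →ₗ[F] Matrix ι ι F :=
  LinearMap.mulLeft F (1 - P) ∘ₗ LinearMap.mulRight F P

theorem offDiagonalBlock_apply (P N : Matrix ι ι F) :
    offDiagonalBlock P N = (1 - P) * (N * P) := rfl

/-- The map `N ↦ ANB` has trace `tr A · tr B`. For idempotent `P` the map is itself idempotent, so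
this computes its rank. -/
theorem trace_offDiagonalBlock (P : Matrix ι ι F) :
    LinearMap.trace F _ (offDiagonalBlock P) = (1 - P).trace * P.trace := by
  rw [LinearMap.trace_eq_matrix_trace F (Matrix.stdBasis F ι ι), Matrix.trace,
    Fintype.sum_prod_type, Matrix.trace, Matrix.trace, Finset.sum_mul_sum]
  refine Finset.sum_congr rfl fun i _ => Finset.sum_congr rfl fun j _ => ?_
  rw [Matrix.diag_apply, LinearMap.toMatrix_apply, Matrix.stdBasis_eq_single,
    offDiagonalBlock_apply]
  have : ∀ M : Matrix ι ι F, (Matrix.stdBasis F ι ι).repr M (i, j) = M i j := fun M => by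
    conv_lhs => rw [Matrix.matrix_eq_sum_single M]
    simp only [map_sum, Finsupp.coe_finsetSum, Finset.sum_apply]
    have h : ∀ a b, Matrix.single a b (M a b) = M a b • Matrix.stdBasis F ι ι (a, b) := by
      intro a b; rw [Matrix.stdBasis_eq_single]; simp
    simp [h, Finsupp.single_apply, ite_and]
  rw [this, Matrix.mul_apply, Finset.sum_eq_single i]
  · simp
  · intro b _ hb
    simp [hb]
  · simp

theorem isIdempotentElem_offDiagonalBlock {P : Matrix ι ι F} (hP : P * P = P) :
    IsIdempotentElem (offDiagonalBlock P) := by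
  have hQ : (1 - P) * (1 - P) = 1 - P := by
    rw [Matrix.mul_sub, Matrix.mul_one, Matrix.sub_mul, Matrix.one_mul, hP, sub_self, sub_zero]
  apply LinearMap.ext
  intro N
  change (1 - P) * (((1 - P) * (N * P)) * P) = (1 - P) * (N * P)
  rw [Matrix.mul_assoc (1 - P) (N * P) P, Matrix.mul_assoc N, hP, ← Matrix.mul_assoc, hQ]

/-- The equation `PM + MP = M` forces `PMP = 0`. If also `(1-P)MP = 0`, then `MP = 0`, and symmetry
gives `M = PM = (MP)ᵀ = 0`. -/
theorem finrank_projTangent_le {P : Matrix ι ι F} (hs : Pᵀ = P) (hP : P * P = P) :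
    Module.finrank F (projTangent P) ≤ Module.finrank F (LinearMap.range (offDiagonalBlock P)) := by
  refine LinearMap.finrank_le_finrank_of_injective
    (f := ((offDiagonalBlock P).rangeRestrict ∘ₗ (projTangent P).subtype)) ?_
  rw [← LinearMap.ker_eq_bot, LinearMap.ker_eq_bot']
  rintro ⟨M, hM1, hM2⟩ h
  have h0 : (1 - P) * (M * P) = 0 := congrArg Subtype.val h
  have h1 : P * M * P = 0 := by
    have := congrArg (fun N => P * N) hM2
    simp only [Matrix.mul_add, ← Matrix.mul_assoc, hP] at this
    simpa using this
  have h2 : M * P = 0 := by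
    rw [Matrix.sub_mul, Matrix.one_mul, ← Matrix.mul_assoc, h1, sub_zero] at h0
    exact h0
  have h3 : P * M = M := by rw [h2, add_zero] at hM2; exact hM2
  have h4 : M = 0 := by
    have := congrArg Matrix.transpose h2
    rwa [Matrix.transpose_mul, hs, hM1, h3, Matrix.transpose_zero] at this
  exact Subtype.ext h4

/-- The diagonal of a tangent vector. -/
def projTangentDiag (P : Matrix ι ι F) : projTangent P →ₗ[F] (ι → F) :=
  Matrix.diagLinearMap ι F F ∘ₗ (projTangent P).subtype

theorem mem_projTangent_offDiagonal {P : Matrix ι ι F} (hs : Pᵀ = P) (hP : P * P = P)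
    (N : Matrix ι ι F) : (1 - P) * N * P + P * Nᵀ * (1 - P) ∈ projTangent P := by
  have hPQ : P * (1 - P) = 0 := by rw [Matrix.mul_sub, Matrix.mul_one, hP, sub_self]
  have hQP : (1 - P) * P = 0 := by rw [Matrix.sub_mul, Matrix.one_mul, hP, sub_self]
  constructor
  · simp only [Matrix.transpose_add, Matrix.transpose_mul, Matrix.transpose_sub,
      Matrix.transpose_one, hs, Matrix.transpose_transpose]
    rw [add_comm]
    simp only [Matrix.mul_assoc]
  · have h1 : P * ((1 - P) * N * P) = 0 := by
      rw [← Matrix.mul_assoc, ← Matrix.mul_assoc, hPQ]; simp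
    have h2 : P * (P * Nᵀ * (1 - P)) = P * Nᵀ * (1 - P) := by
      rw [← Matrix.mul_assoc, ← Matrix.mul_assoc, hP]
    have h3 : (1 - P) * N * P * P = (1 - P) * N * P := by rw [Matrix.mul_assoc, hP]
    have h4 : P * Nᵀ * (1 - P) * P = 0 := by rw [Matrix.mul_assoc, hQP, Matrix.mul_zero]
    rw [Matrix.mul_add, Matrix.add_mul, h1, h2, h3, h4, zero_add, add_zero, add_comm]

/-- A functional on diagonals that kills all tangent vectors comes from a diagonal matrix
commuting with `P`. -/
theorem diagonal_commute_of_annihilates [CharZero F] {P : Matrix ι ι F} (hs : Pᵀ = P)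
    (hP : P * P = P) (e : ι → F)
    (he : ∀ M ∈ projTangent P, (Matrix.diagonal e * M).trace = 0) :
    Matrix.diagonal e * P = P * Matrix.diagonal e := by
  set E := Matrix.diagonal e with hE
  have hEt : Eᵀ = E := Matrix.diagonal_transpose e
  -- Tested on the tangent vector built from `N`, both summands contribute the same trace; after
  -- division by two, nondegeneracy of the trace form applies.
  have h1 : P * E * (1 - P) = 0 := by
    rw [Matrix.ext_iff_trace_mul_right]
    intro N
    have h := he _ (mem_projTangent_offDiagonal hs hP N)
    rw [Matrix.mul_add, Matrix.trace_add] at h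
    have h2 : (E * ((1 - P) * N * P)).trace = (P * E * (1 - P) * N).trace := by
      rw [Matrix.trace_mul_comm, Matrix.trace_mul_comm (P * E * (1 - P)) N, ← Matrix.trace_mul_comm]
      rw [← Matrix.mul_assoc, Matrix.trace_mul_comm, Matrix.trace_mul_comm N]
      simp only [Matrix.mul_assoc]
    have h3 : (E * (P * Nᵀ * (1 - P))).trace = (P * E * (1 - P) * N).trace := by
      rw [← Matrix.trace_transpose]
      simp only [Matrix.transpose_mul, Matrix.transpose_sub, Matrix.transpose_one, hs,
        Matrix.transpose_transpose, hEt]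
      rw [← h2, Matrix.trace_mul_comm]
      simp only [Matrix.mul_assoc]
    rw [h2, h3, ← two_mul] at h
    rw [Matrix.zero_mul, Matrix.trace_zero]
    exact (mul_eq_zero.1 h).resolve_left two_ne_zero
  have h2 : P * E = P * E * P := by
    rw [Matrix.mul_sub, Matrix.mul_one] at h1
    exact sub_eq_zero.1 h1
  have h3 := congrArg Matrix.transpose h2
  simp only [Matrix.transpose_mul, hs, hEt] at h3
  rw [h2, h3, Matrix.mul_assoc]

/-- The annihilator of the range is at most a line: its members come from diagonal matrices
commuting with `P`, which are scalar by `hconst`. -/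
theorem finrank_range_projTangentDiag [CharZero F] [Nonempty ι] {P : Matrix ι ι F} (hs : Pᵀ = P)
    (hP : P * P = P)
    (hconst : ∀ e : ι → F, Matrix.diagonal e * P = P * Matrix.diagonal e → ∀ i j, e i = e j) :
    Fintype.card ι ≤ Module.finrank F (LinearMap.range (projTangentDiag P)) + 1 := by
  have h1 := Subspace.finrank_add_finrank_dualAnnihilator_eq (LinearMap.range (projTangentDiag P))
  rw [Module.finrank_fintype_fun_eq_card] at h1
  rw [← h1]
  gcongr
  obtain ⟨i₀⟩ := ‹Nonempty ι›
  have key : ∀ φ ∈ (LinearMap.range (projTangentDiag P)).dualAnnihilator,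
      φ (Pi.single i₀ 1) = 0 → φ = 0 := by
    intro φ hφ h
    have hsum : ∀ x : ι → F, φ x = ∑ i, φ (Pi.single i 1) * x i := fun x => by
      conv_lhs => rw [LinearMap.pi_apply_eq_sum_univ φ x]
      refine Finset.sum_congr rfl fun i _ => ?_
      rw [smul_eq_mul, mul_comm]
      congr 2
      ext j
      simp [Pi.single_apply, eq_comm]
    have hc := hconst (fun i => φ (Pi.single i 1)) (diagonal_commute_of_annihilates hs hP _ ?_)
    · apply LinearMap.ext
      intro x
      rw [hsum]
      simp [hc _ i₀, h]
    · intro M hM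
      have h2 := (Submodule.mem_dualAnnihilator φ).1 hφ (projTangentDiag P ⟨M, hM⟩) ⟨_, rfl⟩
      rw [hsum] at h2
      simp only [Matrix.trace, Matrix.diag_apply, Matrix.diagonal_mul]
      exact h2
  let f : (LinearMap.range (projTangentDiag P)).dualAnnihilator →ₗ[F] F :=
    LinearMap.applyₗ (Pi.single i₀ 1) ∘ₗ Submodule.subtype _
  refine (LinearMap.finrank_le_finrank_of_injective (f := f) ?_).trans (by simp)
  rintro ⟨φ, hφ⟩ ⟨ψ, hψ⟩ h
  have h : φ (Pi.single i₀ 1) = ψ (Pi.single i₀ 1) := h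
  exact Subtype.ext (sub_eq_zero.1 (key (φ - ψ) (Submodule.sub_mem _ hφ hψ)
    (by rw [LinearMap.sub_apply, h, sub_self])))

/-- The tangent vectors with zero diagonal. -/
def projTangentZeroDiag (P : Matrix ι ι F) : Submodule F (Matrix ι ι F) :=
  (LinearMap.ker (projTangentDiag P)).map (projTangent P).subtype

theorem mem_projTangentZeroDiag {P M : Matrix ι ι F} :
    M ∈ projTangentZeroDiag P ↔ Mᵀ = M ∧ P * M + M * P = M ∧ ∀ i, M i i = 0 := by
  constructor
  · rintro ⟨⟨N, hN⟩, h, rfl⟩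
    exact ⟨hN.1, hN.2, fun i => congrFun h i⟩
  · rintro ⟨h1, h2, h3⟩
    exact ⟨⟨M, h1, h2⟩, funext h3, rfl⟩

theorem finrank_projTangentZeroDiag_le [CharZero F] [Nonempty ι] {P : Matrix ι ι F} (hs : Pᵀ = P)
    (hP : P * P = P)
    (hconst : ∀ e : ι → F, Matrix.diagonal e * P = P * Matrix.diagonal e → ∀ i j, e i = e j)
    {n : ℕ} (hn : P.trace = n) :
    (Module.finrank F (projTangentZeroDiag P) : ℚ) ≤
      ((Fintype.card ι : ℚ) - n) * n - Fintype.card ι + 1 := by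
  have h1 := finrank_range_projTangentDiag hs hP hconst
  have h2 := LinearMap.finrank_range_add_finrank_ker (projTangentDiag P)
  have h3 : Module.finrank F (projTangentZeroDiag P) =
      Module.finrank F (LinearMap.ker (projTangentDiag P)) :=
    Submodule.finrank_map_subtype_eq _ _
  have h4 := finrank_projTangent_le hs hP
  have h5 : (Module.finrank F (LinearMap.range (offDiagonalBlock P)) : ℚ) =
      ((Fintype.card ι : ℚ) - n) * n := by
    have h := (LinearMap.IsIdempotentElem.isProj_range _ (isIdempotentElem_offDiagonalBlock hP)).trace
    rw [trace_offDiagonalBlock, Matrix.trace_sub, Matrix.trace_one, hn] at h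
    have h' : ((((Fintype.card ι : ℚ) - n) * n : ℚ) : F) =
        ((Module.finrank F (LinearMap.range (offDiagonalBlock P)) : ℚ) : F) := by
      push_cast; exact h
    exact (Rat.cast_injective h').symm
  have h1' : (Fintype.card ι : ℚ) ≤
    Module.finrank F (LinearMap.range (projTangentDiag P)) + 1 := by exact_mod_cast h1
  have h2' : (Module.finrank F (LinearMap.range (projTangentDiag P)) : ℚ) +
    Module.finrank F (LinearMap.ker (projTangentDiag P)) =
      Module.finrank F (projTangent P) := by exact_mod_cast h2
  have h4' : (Module.finrank F (projTangent P) : ℚ) ≤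
    Module.finrank F (LinearMap.range (offDiagonalBlock P)) := by exact_mod_cast h4
  rw [h3]
  linarith

theorem exists_nat_trace_eq {P : Matrix ι ι F} (hP : P * P = P) : ∃ n : ℕ, P.trace = n := by
  have h : IsIdempotentElem (Matrix.toLin' P) := by
    change Matrix.toLin' P ∘ₗ Matrix.toLin' P = _
    rw [← Matrix.toLin'_mul, hP]
  have := (LinearMap.IsIdempotentElem.isProj_range _ h).trace
  rw [Matrix.trace_toLin'_eq] at this
  exact ⟨_, this⟩

end Projections

/-! ### Transcendence degree of a projection with constant diagonal -/

section Gram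

variable {k : Type*} [Field k]

theorem isAlgebraic_adjoin_mono {L : Type*} [Field L] [Algebra k L] {s t : Set L} (hst : s ⊆ t)
    {a : L} (ha : IsAlgebraic (Algebra.adjoin k s) a) : IsAlgebraic (Algebra.adjoin k t) a :=
  ha.ringHom_of_comp_eq (Subalgebra.inclusion (Algebra.adjoin_mono hst)).toRingHom (RingHom.id L)
    (Subalgebra.inclusion_injective _) rfl

theorem isAlgebraic_adjoin_image {E L : Type*} [Field E] [Field L] [Algebra k E] [Algebra k L]
    (f : E →ₐ[k] L) {s : Set E} {a : E} (ha : IsAlgebraic (Algebra.adjoin k s) a) :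
    IsAlgebraic (Algebra.adjoin k (f '' s)) (f a) := by
  have hmem : ∀ x : Algebra.adjoin k s, f x ∈ Algebra.adjoin k (f '' s) := fun x => by
    rw [← AlgHom.map_adjoin]
    exact ⟨x, x.2, rfl⟩
  let g : Algebra.adjoin k s →ₐ[k] Algebra.adjoin k (f '' s) :=
    (f.comp (Algebra.adjoin k s).val).codRestrict _ hmem
  refine ha.ringHom_of_comp_eq g.toRingHom f.toRingHom ?_ rfl
  intro x y h
  exact Subtype.ext (f.injective (congrArg Subtype.val h))

theorem map_derivation_mem_projTangentZeroDiag {L : Type*} [Field L] [Algebra k L]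
    {ι : Type*} [Fintype ι] [DecidableEq ι] {P : Matrix ι ι L} (hs : Pᵀ = P) (hP : P * P = P)
    {c : k} (hd : ∀ i, P i i = algebraMap k L c) (D : Derivation k L L) :
    P.map D ∈ projTangentZeroDiag P := by
  rw [mem_projTangentZeroDiag]
  refine ⟨?_, ?_, fun i => by rw [Matrix.map_apply, hd, Derivation.map_algebraMap]⟩
  · rw [← Matrix.transpose_map, hs]
  · ext i j
    have h : P i j = ∑ l, P i l * P l j := by conv_lhs => rw [← hP, Matrix.mul_apply]
    rw [Matrix.map_apply, h, map_sum, Matrix.add_apply, Matrix.mul_apply, Matrix.mul_apply,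
      ← Finset.sum_add_distrib]
    refine Finset.sum_congr rfl fun l _ => ?_
    rw [Derivation.leibniz, smul_eq_mul, smul_eq_mul, Matrix.map_apply, Matrix.map_apply,
      mul_comm (P l j)]

/-- The derivation bound requires the entries of `P` to generate the field, so `P` and its
hypotheses are first descended to the subfield `E` they generate. -/
theorem exists_finset_of_connected [CharZero k] {L : Type*} [Field L] [Algebra k L]
    {ι : Type*} [Fintype ι] [DecidableEq ι] [Nonempty ι] {P : Matrix ι ι L}
    (hs : Pᵀ = P) (hP : P * P = P) {c : k} (hd : ∀ i, P i i = algebraMap k L c)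
    (hconst : ∀ e : ι → L, Matrix.diagonal e * P = P * Matrix.diagonal e → ∀ i j, e i = e j)
    {n : ℕ} (hn : P.trace = n) :
    ∃ s : Finset L, (s.card : ℚ) ≤ ((Fintype.card ι : ℚ) - n) * n - Fintype.card ι + 1 ∧
      ∀ i j, IsAlgebraic (Algebra.adjoin k (s : Set L)) (P i j) := by
  classical
  set S : Set L := Set.range fun x : ι × ι => P x.1 x.2
  set E := IntermediateField.adjoin k S with hE
  have hmem : ∀ i j, P i j ∈ E := fun i j => IntermediateField.subset_adjoin k S ⟨(i, j), rfl⟩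
  let P' : Matrix ι ι E := Matrix.of fun i j => ⟨P i j, hmem i j⟩
  have hmap : P'.map (algebraMap E L) = P := rfl
  have hinj : Function.Injective fun M : Matrix ι ι E => M.map (algebraMap E L) :=
    Matrix.map_injective (algebraMap E L).injective
  have hs' : P'ᵀ = P' := hinj (show P'ᵀ.map (algebraMap E L) = P'.map (algebraMap E L) from hs)
  have hP' : P' * P' = P' := hinj (show (P' * P').map (algebraMap E L) = P'.map (algebraMap E L) by
    rw [Matrix.map_mul, hmap, hP])
  have hd' : ∀ i, P' i i = algebraMap k E c := fun i => Subtype.ext (hd i)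
  have hn' : P'.trace = n := by
    apply (algebraMap E L).injective
    rw [map_natCast, ← hn]
    simp [Matrix.trace, P', IntermediateField.algebraMap_apply]
  have hconst' : ∀ e : ι → E, Matrix.diagonal e * P' = P' * Matrix.diagonal e →
      ∀ i j, e i = e j := by
    intro e he i j
    have h := hconst (fun i => algebraMap E L (e i)) ?_ i j
    · exact (algebraMap E L).injective h
    · have h1 := congrArg (fun M : Matrix ι ι E => M.map (algebraMap E L)) he
      simp only [Matrix.map_mul, hmap, Matrix.diagonal_map (map_zero (algebraMap E L))] at h1
      exact h1
  have : CharZero E := charZero_of_injective_algebraMap (algebraMap k E).injective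
  have hG : IntermediateField.adjoin k (Set.range fun x : ι × ι => P' x.1 x.2) = ⊤ := by
    apply IntermediateField.lift_injective E
    have himg : E.val '' (Set.range fun x : ι × ι => P' x.1 x.2) = S := by
      rw [← Set.range_comp]; rfl
    rw [IntermediateField.lift_adjoin, IntermediateField.lift_top]
    exact congrArg (IntermediateField.adjoin k) himg
  let ε : (ι × ι → E) ≃ₗ[E] Matrix ι ι E := LinearEquiv.curry E E ι ι
  obtain ⟨s, hcard, halg⟩ := exists_finset_of_derivation_mem (fun x : ι × ι => P' x.1 x.2) hG
    ((projTangentZeroDiag P').map ε.symm.toLinearMap)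
    (fun D => ⟨P'.map D, map_derivation_mem_projTangentZeroDiag hs' hP' hd' D, rfl⟩)
  have h1 := finrank_projTangentZeroDiag_le hs' hP' hconst' hn'
  rw [LinearEquiv.finrank_map_eq] at hcard
  refine ⟨s.image E.val, ?_, fun i j => ?_⟩
  · refine le_trans ?_ h1
    exact_mod_cast Finset.card_image_le.trans hcard
  · rw [Finset.coe_image]
    exact isAlgebraic_adjoin_image E.val (halg.isAlgebraic (P' i j))

theorem toSquareBlockProp_mul_self_of_block {L : Type*} [Field L] {ι : Type*} [Fintype ι]
    {P : Matrix ι ι L} (hP : P * P = P) (q : ι → Prop) [DecidablePred q]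
    (hq : ∀ i j, q i → ¬ q j → P i j = 0) :
    P.toSquareBlockProp q * P.toSquareBlockProp q = P.toSquareBlockProp q := by
  ext i j
  have h : P i j = ∑ l, P i l * P l j := by conv_lhs => rw [← hP, Matrix.mul_apply]
  rw [Matrix.toSquareBlockProp_def, Matrix.mul_apply, Matrix.of_apply, h,
    ← Fintype.sum_subtype_add_sum_subtype q]
  have h0 : ∑ l : {l // ¬ q l}, P i l * P l j = 0 :=
    Finset.sum_eq_zero fun l _ => by rw [hq i l i.2 l.2, zero_mul]
  rw [h0, add_zero]
  rfl

/-- The entries of a symmetric idempotent matrix of rank `n` with constant diagonal generate a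
field of transcendence degree at most `(r - n) n - r + 1`. -/
theorem exists_finset_of_constant_diagonal [CharZero k] {L : Type*} [Field L] [Algebra k L]
    {c : ℚ} (hc : 1 < c) (m : ℕ) :
    ∀ {ι : Type} [Fintype ι] [DecidableEq ι] [Nonempty ι], Fintype.card ι = m →
    ∀ {P : Matrix ι ι L}, Pᵀ = P → P * P = P →
    (∀ i, P i i = algebraMap k L ((c⁻¹ : ℚ) : k)) →
    ∃ n : ℕ, (m : ℚ) = c * n ∧ ∃ s : Finset L, (s.card : ℚ) ≤ ((m : ℚ) - n) * n - m + 1 ∧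
      ∀ i j, IsAlgebraic (Algebra.adjoin k (s : Set L)) (P i j) := by
  induction m using Nat.strong_induction_on with
  | _ m ih =>
  intro ι _ _ hne hcard P hs hP hd
  classical
  have hL : CharZero L := charZero_of_injective_algebraMap (algebraMap k L).injective
  obtain ⟨n, hn⟩ := exists_nat_trace_eq hP
  have hmn : (m : ℚ) = c * n := by
    have h1 : P.trace = ((m * c⁻¹ : ℚ) : L) := by
      simp [Matrix.trace, hd, hcard]
    rw [hn] at h1
    have h2 : (n : ℚ) = m * c⁻¹ := Rat.cast_injective (α := L) (by rw [← h1]; simp)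
    rw [h2]
    field_simp
  refine ⟨n, hmn, ?_⟩
  by_cases hconst : ∀ e : ι → L, Matrix.diagonal e * P = P * Matrix.diagonal e → ∀ i j, e i = e j
  · rw [← hcard]
    exact exists_finset_of_connected hs hP hd hconst hn
  -- Commuting with `diagonal e` means `P i j = 0` whenever `e i ≠ e j`; hence `P` splits along the
  -- level set of `e i₀` and its complement.
  push Not at hconst
  obtain ⟨e, he, i₀, j₀, hij⟩ := hconst
  have hzero : ∀ i j, e i ≠ e j → P i j = 0 := by
    intro i j h
    have h1 := congrFun (congrFun he i) j
    rw [Matrix.diagonal_mul, Matrix.mul_diagonal, mul_comm (P i j)] at h1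
    by_contra h2
    exact h (mul_right_cancel₀ h2 h1)
  let q : ι → Prop := fun i => e i = e i₀
  have hq1 : ∀ i j, q i → ¬ q j → P i j = 0 := fun i j hi hj =>
    hzero i j fun h => hj (h.symm.trans hi)
  have hq2 : ∀ i j, ¬ q i → ¬ ¬ q j → P i j = 0 := fun i j hi hj =>
    hzero i j fun h => hi (h.trans (not_not.1 hj))
  have hne1 : Nonempty {i // q i} := ⟨⟨i₀, rfl⟩⟩
  have hne2 : Nonempty {i // ¬ q i} := ⟨⟨j₀, fun h => hij h.symm⟩⟩
  have hsum : Fintype.card {i // q i} + Fintype.card {i // ¬ q i} = m := by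
    rw [Fintype.card_subtype_compl, hcard]
    have := Fintype.card_subtype_le q
    omega
  have hpos1 : 0 < Fintype.card {i // q i} := Fintype.card_pos
  have hpos2 : 0 < Fintype.card {i // ¬ q i} := Fintype.card_pos
  obtain ⟨n₁, hn₁, s₁, hs₁, halg₁⟩ := ih _ (by omega) (ι := {i // q i}) rfl
    (P := P.toSquareBlockProp q)
    (Matrix.ext fun i j => congrFun (congrFun hs i) j)
    (toSquareBlockProp_mul_self_of_block hP q hq1) (fun i => hd i)
  obtain ⟨n₂, hn₂, s₂, hs₂, halg₂⟩ := ih _ (by omega) (ι := {i // ¬ q i}) rfl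
    (P := P.toSquareBlockProp fun i => ¬ q i)
    (Matrix.ext fun i j => congrFun (congrFun hs i) j)
    (toSquareBlockProp_mul_self_of_block hP (fun i => ¬ q i) hq2) (fun i => hd i)
  refine ⟨s₁ ∪ s₂, ?_, fun i j => ?_⟩
  · generalize Fintype.card {i // q i} = m₁ at *
    generalize Fintype.card {i // ¬ q i} = m₂ at *
    have hcs : ((s₁ ∪ s₂).card : ℚ) ≤ s₁.card + s₂.card := by
      exact_mod_cast Finset.card_union_le _ _
    have hm : (m : ℚ) = m₁ + m₂ := by exact_mod_cast hsum.symm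
    have hn12 : (n : ℚ) = n₁ + n₂ := by
      have : c * n = c * (n₁ + n₂) := by rw [← hmn, hm, hn₁, hn₂]; ring
      exact mul_left_cancel₀ (by positivity) this
    have hn2 : (1 : ℚ) ≤ n₂ := by
      have : n₂ ≠ 0 := by
        rintro rfl
        simp at hn₂
        omega
      exact_mod_cast Nat.one_le_iff_ne_zero.2 this
    have hn1 : (0 : ℚ) < n₁ := by
      have : n₁ ≠ 0 := by
        rintro rfl
        simp at hn₁
        omega
      exact_mod_cast Nat.pos_of_ne_zero this
    have hr1 : (1 : ℚ) ≤ m₁ - n₁ := by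
      have : (n₁ : ℚ) < m₁ := by rw [hn₁]; nlinarith
      have : n₁ + 1 ≤ m₁ := by exact_mod_cast this
      have : ((n₁ + 1 : ℕ) : ℚ) ≤ m₁ := by exact_mod_cast this
      push_cast at this
      linarith
    -- As `mᵢ = c nᵢ` for both blocks, the two cross terms coincide; each is at least 1, which
    -- outweighs the extra `+ 1` from having two blocks.
    have hr : ((m : ℚ) - n) * n - m + 1 - (((m₁ : ℚ) - n₁) * n₁ - m₁ + 1) -
        (((m₂ : ℚ) - n₂) * n₂ - m₂ + 1) = 2 * (m₁ - n₁) * n₂ - 1 := by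
      rw [hn12, hm, hn₁, hn₂]; ring
    nlinarith
  · by_cases hi : q i <;> by_cases hj : q j
    · exact isAlgebraic_adjoin_mono (by simp) (halg₁ ⟨i, hi⟩ ⟨j, hj⟩)
    · rw [hq1 i j hi hj]; exact isAlgebraic_zero
    · rw [hq2 i j hi (not_not.2 hj)]; exact isAlgebraic_zero
    · exact isAlgebraic_adjoin_mono (by simp) (halg₂ ⟨i, hi⟩ ⟨j, hj⟩)

end Gram

/-! ### Krull dimension bounds -/

section KrullDimension

/-- The dimension of a quotient is bounded by the dimensions of the domains it dominates. -/
theorem ringKrullDim_quotient_le_of_forall_prime {R : Type*} [CommRing R] (I : Ideal R)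
    {d : WithBot ℕ∞} (h : ∀ P : Ideal R, P.IsPrime → I ≤ P → ringKrullDim (R ⧸ P) ≤ d) :
    ringKrullDim (R ⧸ I) ≤ d := by
  rw [ringKrullDim_quotient]
  refine iSup_le fun l => ?_
  -- A chain of primes over `I` lies over its smallest member, itself a prime containing `I`.
  refine le_trans ?_ (h l.head.1.asIdeal l.head.1.isPrime l.head.2)
  rw [ringKrullDim_quotient]
  let l' : LTSeries (PrimeSpectrum.zeroLocus (l.head.1.asIdeal : Set R)) :=
    { length := l.length
      toFun := fun i => ⟨(l.toFun i).1, (LTSeries.head_le l i : l.head ≤ l.toFun i)⟩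
      step := fun i => l.step i }
  exact le_iSup (fun q : LTSeries (PrimeSpectrum.zeroLocus (l.head.1.asIdeal : Set R)) =>
    (q.length : WithBot ℕ∞)) l'

theorem ringKrullDim_le_of_isIntegral {R S : Type*} [CommRing R] [CommRing S] (f : R →+* S)
    (hf : f.IsIntegral) : ringKrullDim S ≤ ringKrullDim R := by
  let := f.toAlgebra
  have : Algebra.IsIntegral R S := ⟨hf⟩
  refine Order.krullDim_le_of_strictMono (fun Q : PrimeSpectrum S => PrimeSpectrum.comap f Q) ?_
  intro Q Q' h
  exact Ideal.IsIntegral.comap_lt_comap h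

/-- By Noether normalization `A` is integral over a polynomial ring. Its variables become
algebraically independent in `L` and lie in the closure of `s` in the algebraic matroid, so there
are at most `s.card` of them. -/
theorem ringKrullDim_le_of_isAlgebraic {k A L : Type*} [Field k] [CommRing A] [IsDomain A]
    [Algebra k A] [Algebra.FiniteType k A] [Field L] [Algebra k L] (f : A →ₐ[k] L)
    (hf : Function.Injective f) (s : Finset L)
    (h : ∀ a, IsAlgebraic (Algebra.adjoin k (s : Set L)) (f a)) :
    ringKrullDim A ≤ s.card := by
  obtain ⟨m, g, hg, hgi⟩ := exists_integral_inj_algHom_of_fg k A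
  have h1 := ringKrullDim_le_of_isIntegral g.toRingHom hgi
  rw [MvPolynomial.ringKrullDim_of_isNoetherianRing, ringKrullDim_eq_zero_of_field, zero_add,
    Nat.card_eq_fintype_card, Fintype.card_fin] at h1
  refine h1.trans ?_
  have hy : AlgebraicIndependent k fun i : Fin m => f (g (MvPolynomial.X i)) := by
    have := (MvPolynomial.algebraicIndependent_X (Fin m) k).map' (f := f.comp g) (hf.comp hg)
    exact this
  have hind : (AlgebraicIndependent.matroid k L).Indep
      (Set.range fun i : Fin m => f (g (MvPolynomial.X i))) :=
    AlgebraicIndependent.matroid_indep_iff.2 hy.to_subtype_range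
  have hsub : (Set.range fun i : Fin m => f (g (MvPolynomial.X i))) ⊆
      (AlgebraicIndependent.matroid k L).closure s := by
    rw [AlgebraicIndependent.matroid_closure_eq]
    rintro _ ⟨i, rfl⟩
    exact h _
  have h2 := hind.encard_le_eRk_of_subset hsub
  rw [Matroid.eRk_closure_eq] at h2
  have h3 := h2.trans (Matroid.eRk_le_encard _ _)
  rw [Set.encard_coe_eq_coe_finsetCard, ← Set.image_univ,
    Function.Injective.encard_image hy.injective, Set.encard_univ, ENat.card_eq_coe_fintype_card,
    Fintype.card_fin] at h3
  exact_mod_cast h3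

end KrullDimension

/-! ### Upper bound for the dimension -/

section Upper

variable {n r : ℕ}

/-- The entries of the projection onto the row space of a matrix determine its minors up to
algebraic functions. -/
theorem isAlgebraic_maximalMinors {k L : Type*} [Field k] [Field L] [Algebra k L]
    (V : Matrix (Fin n) (Fin r) L) {δ : k} (hdet : (V * Vᵀ).det = algebraMap k L δ) (hδ : δ ≠ 0)
    (s : Set L)
    (hs : ∀ i j, IsAlgebraic (Algebra.adjoin k s) ((Vᵀ * (V * Vᵀ)⁻¹ * V) i j))
    (I : PluckerIndex n r) : IsAlgebraic (Algebra.adjoin k s) (maximalMinors V I) := by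
  set P := Vᵀ * (V * Vᵀ)⁻¹ * V with hP
  have hδ' : algebraMap k L δ ≠ 0 := by simpa using hδ
  -- The principal block of `P` at `I` is `V_Iᵀ(VVᵀ)⁻¹V_I`, so the squared minor is polynomial in
  -- the entries of `P`.
  have h1 : (P.submatrix I.emb I.emb).det * algebraMap k L δ = maximalMinors V I ^ 2 := by
    have h : P.submatrix I.emb I.emb =
        (V.submatrix id I.emb)ᵀ * (V * Vᵀ)⁻¹ * V.submatrix id I.emb := rfl
    rw [h, Matrix.det_mul, Matrix.det_mul, Matrix.det_transpose, Matrix.det_nonsing_inv, hdet,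
      Ring.inverse_eq_inv', maximalMinors]
    field_simp
  have h2 : (P.submatrix I.emb I.emb).det ∈
      Subalgebra.algebraicClosure (Algebra.adjoin k s) L := by
    rw [Matrix.det_apply]
    refine Subalgebra.sum_mem _ fun σ _ => ?_
    rw [Units.smul_def]
    exact Subalgebra.zsmul_mem _ (Subalgebra.prod_mem _ fun i _ => hs _ _) _
  have h3 : algebraMap k L δ ∈ Subalgebra.algebraicClosure (Algebra.adjoin k s) L :=
    isAlgebraic_algebraMap (algebraMap k (Algebra.adjoin k s) δ)
  have h4 := Subalgebra.mul_mem _ h2 h3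
  rw [h1] at h4
  exact IsAlgebraic.of_pow two_pos h4

open MvPolynomial in
theorem affineDim_funtfPluckerImage_le (hn : 1 ≤ n) (hr : n < r) :
    affineDim (funtfPluckerImage n r) ≤ (((r - n) * n - r + 1 : ℤ).toNat : ℕ∞) := by
  refine ringKrullDim_quotient_le_of_forall_prime _ fun Q hQ hIQ => ?_
  let B := MvPolynomial (PluckerIndex n r) ℂ ⧸ Q
  let L := FractionRing B
  let φ : MvPolynomial (PluckerIndex n r) ℂ →ₐ[ℂ] L :=
    (IsScalarTower.toAlgHom ℂ B L).comp (Ideal.Quotient.mkₐ ℂ Q)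
  have hφ : ∀ f ∈ vanishingIdeal ℂ (funtfPluckerImage n r), φ f = 0 := by
    intro f hf
    change algebraMap B L (Ideal.Quotient.mk Q f) = 0
    rw [Ideal.Quotient.eq_zero_iff_mem.2 (hIQ hf), map_zero]
  -- The tautological point over the residue field at `Q`; it satisfies every equation of the image,
  -- since `Q` contains the vanishing ideal.
  let p : PluckerIndex n r → L := fun I => φ (X I)
  have hrel : ∀ I J, pluckerRelation p I J = 0 := by
    intro I J
    rw [← hφ (pluckerRelation X I J) ?_]
    · exact (map_pluckerRelation φ.toRingHom X I J).symm
    · intro x hx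
      have := map_pluckerRelation (aeval (R := ℂ) x).toRingHom
        (X : PluckerIndex n r → MvPolynomial (PluckerIndex n r) ℂ) I J
      refine this.trans ?_
      simpa using ((mem_funtfPluckerImage_iff_equations hn hr.le x).1 hx).1 I J
  have hsq : ∀ i, squareSum p i = ((r : L) / n) ^ (n - 1) := by
    intro i
    rw [← sub_eq_zero]
    rw [← hφ (squareSum X i - C (((r : ℂ) / n) ^ (n - 1))) ?_]
    · rw [map_sub]
      congr 1
      · exact (map_squareSum φ.toRingHom X i).symm
      · rw [← algebraMap_eq, AlgHom.commutes]; simp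
    · intro x hx
      have h1 := map_squareSum (aeval (R := ℂ) x).toRingHom
        (X : PluckerIndex n r → MvPolynomial (PluckerIndex n r) ℂ) i
      have h2 := ((mem_funtfPluckerImage_iff_equations hn hr.le x).1 hx).2 i
      rw [map_sub, sub_eq_zero]
      refine h1.trans ?_
      simpa using h2
  obtain ⟨V, hV⟩ := (mem_range_maximalMinors_iff hn p).2 hrel
  have hL : CharZero L := charZero_of_injective_algebraMap (algebraMap ℂ L).injective
  have hc := frame_bound_ne_zero (K := L) hn hr.le
  have hdet := det_mul_transpose_of_squareSum hn V (by rw [hV]; exact hsq)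
  have hdet0 : (V * Vᵀ).det ≠ 0 := by rw [hdet]; exact pow_ne_zero _ hc
  have hu : IsUnit (V * Vᵀ).det := hdet0.isUnit
  have hSt : (V * Vᵀ)ᵀ = V * Vᵀ := by rw [Matrix.transpose_mul, Matrix.transpose_transpose]
  set P := Vᵀ * (V * Vᵀ)⁻¹ * V with hP
  have hPs : Pᵀ = P := by
    rw [hP, Matrix.transpose_mul, Matrix.transpose_mul, Matrix.transpose_nonsing_inv, hSt,
      Matrix.transpose_transpose, Matrix.mul_assoc]
  have hPP : P * P = P := by
    calc P * P = Vᵀ * (V * Vᵀ)⁻¹ * ((V * Vᵀ) * (V * Vᵀ)⁻¹) * V := by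
          rw [hP]; simp only [Matrix.mul_assoc]
      _ = P := by rw [Matrix.mul_nonsing_inv _ hu, Matrix.mul_one]
  have hPd : ∀ i, P i i = algebraMap ℂ L (((((r : ℚ) / n)⁻¹ : ℚ)) : ℂ) := by
    intro i
    have h := squareSum_maximalMinors V hdet0 i
    rw [hV, hsq, hdet, ← hP] at h
    obtain ⟨m, rfl⟩ : ∃ m, n = m + 1 := ⟨n - 1, by omega⟩
    rw [Nat.add_sub_cancel, pow_succ, mul_assoc] at h
    have h1 := mul_left_cancel₀ (pow_ne_zero _ hc) ((mul_one _).trans h)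
    rw [eq_comm, mul_comm] at h1
    rw [eq_inv_of_mul_eq_one_left h1]; simp
  have : Nonempty (Fin r) := ⟨⟨0, by omega⟩⟩
  have hc1 : (1 : ℚ) < (r : ℚ) / n := by
    rw [one_lt_div (by exact_mod_cast hn)]; exact_mod_cast hr
  obtain ⟨n', hn', s, hscard, hs⟩ := exists_finset_of_constant_diagonal (k := ℂ) hc1 r
    (Fintype.card_fin r) hPs hPP hPd
  have hnn : (n' : ℚ) = n := by
    have h1 : (r : ℚ) / n ≠ 0 := frame_bound_ne_zero hn hr.le
    apply mul_left_cancel₀ h1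
    rw [← hn']
    have : (n : ℚ) ≠ 0 := by exact_mod_cast (by omega : n ≠ 0)
    field_simp
  rw [hnn] at hscard
  have hle : s.card ≤ (((r : ℤ) - n) * n - r + 1).toNat := by
    have : (s.card : ℤ) ≤ ((r : ℤ) - n) * n - r + 1 := by exact_mod_cast hscard
    omega
  refine le_trans ?_ (WithBot.coe_le_coe.2 (Nat.cast_le.2 hle))
  have hmin : ∀ I, IsAlgebraic (Algebra.adjoin ℂ (s : Set L)) (p I) := by
    rw [← hV]
    refine isAlgebraic_maximalMinors V (δ := ((r : ℂ) / n) ^ n) (by rw [hdet]; simp) ?_ _ hs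
    exact pow_ne_zero _ (frame_bound_ne_zero hn hr.le)
  refine ringKrullDim_le_of_isAlgebraic (IsScalarTower.toAlgHom ℂ B L)
    (IsFractionRing.injective B L) s fun b => ?_
  obtain ⟨f, rfl⟩ := Ideal.Quotient.mk_surjective b
  change φ f ∈ Subalgebra.algebraicClosure (Algebra.adjoin ℂ (s : Set L)) L
  induction f using MvPolynomial.induction_on with
  | C a =>
    rw [← algebraMap_eq, AlgHom.commutes]
    exact isAlgebraic_algebraMap (algebraMap ℂ (Algebra.adjoin ℂ (s : Set L)) a)
  | add f g hf hg => rw [map_add]; exact add_mem hf hg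
  | mul_X f I hf => rw [map_mul]; exact mul_mem hf (hmin I)

end Upper

/-! ### Existence of complex frames -/

section Harmonic

theorem sum_zpow_mul_eq_zero {r : ℕ} {ζ : ℂ} (hζ : IsPrimitiveRoot ζ r) {a : ℤ}
    (ha : a ≠ 0) (har : |a| < r) : ∑ j : Fin r, ζ ^ (a * (j : ℤ)) = 0 := by
  have hne : ζ ^ a ≠ 1 := fun h => by
    obtain ⟨b, rfl⟩ := (hζ.zpow_eq_one_iff_dvd a).1 h
    have hb : b ≠ 0 := by rintro rfl; simp at ha
    have : (1 : ℤ) ≤ |b| := Int.one_le_abs hb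
    rw [abs_mul, Nat.abs_cast] at har
    nlinarith
  have h1 : ∑ j : Fin r, ζ ^ (a * (j : ℤ)) = ∑ j ∈ Finset.range r, (ζ ^ a) ^ j := by
    rw [← Fin.sum_univ_eq_sum_range (fun j => (ζ ^ a) ^ j)]
    exact Finset.sum_congr rfl fun j _ => by rw [_root_.zpow_mul, zpow_natCast]
  rw [h1, geom_sum_eq hne, ← zpow_natCast, ← _root_.zpow_mul, mul_comm, _root_.zpow_mul, zpow_natCast,
    hζ.pow_eq_one]
  simp

/-- Complex funtfs exist: rescaled harmonic frames. -/
theorem funtf_complex_nonempty {n r : ℕ} (hn : 1 ≤ n) (hr : n ≤ r) : (funtf ℂ n r).Nonempty := by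
  have hr0 : r ≠ 0 := by omega
  -- A `2r`-th root lets the exponents be centred at zero: rows `i` and `n-1-i` are then entrywise
  -- inverse, and `W * Wᵀ` is `r` times the reversal matrix `J`.
  set ω : ℂ := Complex.exp (2 * Real.pi * Complex.I / (2 * r : ℕ)) with hω
  have hω1 : IsPrimitiveRoot ω (2 * r) := Complex.isPrimitiveRoot_exp _ (by omega)
  have hω2 : IsPrimitiveRoot (ω ^ 2) r := hω1.pow (by omega) rfl
  have hω0 : ω ≠ 0 := Complex.exp_ne_zero _
  let W : Matrix (Fin n) (Fin r) ℂ :=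
    Matrix.of fun i j => ω ^ ((2 * (i : ℤ) - (n - 1)) * (j : ℤ))
  let J : Matrix (Fin n) (Fin n) ℂ := Matrix.of fun i l => if l = i.rev then 1 else 0
  have hJt : Jᵀ = J := by
    ext i l
    simp only [J, Matrix.transpose_apply, Matrix.of_apply]
    congr 1
    rw [eq_iff_iff]
    constructor <;> (rintro rfl; simp)
  have hJJ : J * J = 1 := by
    ext i l
    rw [Matrix.mul_apply, Finset.sum_eq_single i.rev]
    · simp [J, Matrix.one_apply, eq_comm]
    · intro b _ hb
      simp [J, hb]
    · simp
  have hWW : W * Wᵀ = (r : ℂ) • J := by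
    ext i l
    simp only [W, J, Matrix.mul_apply, Matrix.transpose_apply, Matrix.of_apply, Matrix.smul_apply,
      smul_eq_mul]
    have h1 : ∀ j : Fin r, ω ^ ((2 * (i : ℤ) - (n - 1)) * (j : ℤ)) *
        ω ^ ((2 * (l : ℤ) - (n - 1)) * (j : ℤ)) = (ω ^ 2) ^ (((i : ℤ) + l - (n - 1)) * (j : ℤ)) := by
      intro j
      rw [← zpow_add₀ hω0, ← zpow_natCast ω 2, ← _root_.zpow_mul]
      congr 1
      push_cast
      ring
    simp only [h1]
    have hi := i.2
    have hl := l.2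
    have hrev : ((i.rev : ℕ) : ℤ) = n - 1 - i := by rw [Fin.val_rev]; omega
    split_ifs with h
    · have h0 : (i : ℤ) + l - (n - 1) = 0 := by rw [h, hrev]; ring
      simp [h0]
    · rw [mul_zero]
      refine sum_zpow_mul_eq_zero hω2 (fun h0 => h ?_) ?_
      · apply Fin.ext
        have : ((l : ℕ) : ℤ) = (i.rev : ℕ) := by rw [hrev]; linarith
        exact_mod_cast this
      · rw [abs_lt]; constructor <;> omega
  have hWJW : ∀ j, (Wᵀ * J * W) j j = n := by
    intro j
    have h1 : ∀ i, (Wᵀ * J) j i = W i.rev j := by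
      intro i
      rw [Matrix.mul_apply, Finset.sum_eq_single i.rev]
      · simp [J]
      · intro b _ hb
        have : i ≠ b.rev := fun h => hb (by rw [h, Fin.rev_rev])
        simp [J, this]
      · simp
    rw [Matrix.mul_apply]
    have h2 : ∀ i, (Wᵀ * J) j i * W i j = 1 := by
      intro i
      have hrev : ((i.rev : ℕ) : ℤ) = n - 1 - i := by rw [Fin.val_rev]; have := i.2; omega
      rw [h1]
      simp only [W, Matrix.of_apply]
      rw [← zpow_add₀ hω0, hrev]
      convert zpow_zero ω using 2
      ring
    simp [h2]
  -- A change of basis by `A⁻¹` turns the form `J` into the standard one, and `J² = 1` gives `A⁻¹ᵀ *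
  -- A⁻¹ = J`, which preserves the column computation `hWJW`.
  obtain ⟨A, hA⟩ := exists_mul_transpose_eq_complex J hJt
  have hAu : IsUnit A.det := by
    have h := congrArg Matrix.det hJJ
    rw [← hA] at h
    simp only [Matrix.det_mul, Matrix.det_transpose, Matrix.det_one] at h
    exact IsUnit.of_mul_eq_one (A.det * (A.det * A.det)) (by rw [← h]; ring)
  obtain ⟨s, hs⟩ := IsAlgClosed.exists_eq_mul_self (n : ℂ)
  have hn0 : (n : ℂ) ≠ 0 := by exact_mod_cast (by omega : n ≠ 0)
  have hs' : s⁻¹ * s⁻¹ = (n : ℂ)⁻¹ := by rw [hs, mul_inv]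
  have hAJA : A⁻¹ * J * A⁻¹ᵀ = 1 := by
    rw [← hA, Matrix.mul_assoc, Matrix.mul_assoc, ← Matrix.transpose_mul,
      Matrix.nonsing_inv_mul _ hAu, Matrix.transpose_one, Matrix.mul_one,
      Matrix.nonsing_inv_mul _ hAu]
  have hAA : A⁻¹ᵀ * A⁻¹ = J := by
    rw [Matrix.transpose_nonsing_inv, ← Matrix.mul_inv_rev, hA]
    exact Matrix.inv_eq_right_inv hJJ
  refine ⟨s⁻¹ • (A⁻¹ * W), ?_, fun j => ?_⟩
  · rw [Matrix.transpose_smul, Matrix.smul_mul, Matrix.mul_smul, smul_smul, hs',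
      Matrix.transpose_mul, Matrix.mul_assoc, ← Matrix.mul_assoc W, hWW, Matrix.smul_mul,
      Matrix.mul_smul, ← Matrix.mul_assoc, hAJA, smul_smul, div_eq_inv_mul]
  · rw [← transpose_mul_self_diag, Matrix.transpose_smul, Matrix.smul_mul, Matrix.mul_smul,
      smul_smul, hs', Matrix.transpose_mul, Matrix.mul_assoc, ← Matrix.mul_assoc A⁻¹ᵀ, hAA,
      ← Matrix.mul_assoc, Matrix.smul_apply, hWJW, smul_eq_mul, inv_mul_cancel₀ hn0]

end Harmonic

/-! ### Height of the ideal of a point -/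

section PointHeight

open MvPolynomial

/-- Translation of the variables. -/
noncomputable def translateEquiv {σ K : Type*} [CommRing K] (v : σ → K) :
    MvPolynomial σ K ≃ₐ[K] MvPolynomial σ K :=
  AlgEquiv.ofAlgHom (aeval fun i => X i + C (v i)) (aeval fun i => X i - C (v i))
    (by ext i; simp [← algebraMap_eq]) (by ext i; simp [← algebraMap_eq])

/-- Some maximal ideal attains the dimension; by the Nullstellensatz it belongs to a point, and
translations move it to any other point. -/
theorem height_vanishingIdeal_singleton {σ K : Type*} [Field K] [IsAlgClosed K] [Finite σ]
    (x : σ → K) : (vanishingIdeal K {x}).height = Nat.card σ := by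
  have hdim : ringKrullDim (MvPolynomial σ K) = Nat.card σ := by
    rw [ringKrullDim_of_isNoetherianRing, ringKrullDim_eq_zero_of_field, zero_add]
  have : FiniteRingKrullDim (MvPolynomial σ K) := by
    rw [finiteRingKrullDim_iff_ne_bot_and_top, hdim]
    exact ⟨WithBot.natCast_ne_bot _, fun h => ENat.natCast_ne_top _ (WithBot.coe_inj.1 h)⟩
  obtain ⟨m, hm, hh⟩ := Ideal.exists_isMaximal_height (R := MvPolynomial σ K)
  obtain ⟨y, rfl⟩ := isMaximal_iff_eq_vanishingIdeal_singleton.1 hm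
  have h1 : vanishingIdeal K {x} =
      (vanishingIdeal K {y}).comap (translateEquiv (x - y)).toRingEquiv := by
    ext p
    rw [Ideal.mem_comap, mem_vanishingIdeal_singleton_iff, mem_vanishingIdeal_singleton_iff]
    have h2 : (aeval y).comp (translateEquiv (x - y)).toAlgHom = aeval x := by
      ext i
      simp [translateEquiv]
    rw [← h2]
    rfl
  rw [h1, RingEquiv.height_comap]
  rw [hdim] at hh
  exact_mod_cast hh

end PointHeight

/-! ### Affine charts and the lower bound for the dimension -/

section Chart

open MvPolynomial

variable {n r : ℕ}

/-- The coordinates of the affine chart of the Grassmannian cone where the coordinate with index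
`I` does not vanish: this coordinate itself, and the entries outside the columns in `I`. -/
abbrev ChartIndex (I : PluckerIndex n r) : Type := Option (Fin n × {j : Fin r // j ∉ I.1})

/-- The generic matrix with an identity block in the columns in `I`. -/
noncomputable def genericChart (I : PluckerIndex n r) :
    Matrix (Fin n) (Fin r) (MvPolynomial (ChartIndex I) ℂ) :=
  Matrix.of fun i j =>
    if h : j ∈ I.1 then (if I.emb i = j then 1 else 0) else X (some (i, ⟨j, h⟩))

theorem genericChart_submatrix (I : PluckerIndex n r) :
    (genericChart I).submatrix id I.emb = 1 := by
  ext1 i b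
  simp [genericChart, I.emb_mem b, Matrix.one_apply]

/-- The coordinates of the generic point of the chart. -/
noncomputable def chartPoint (I : PluckerIndex n r) :
    PluckerIndex n r → MvPolynomial (ChartIndex I) ℂ :=
  (X none : MvPolynomial (ChartIndex I) ℂ) • maximalMinors (genericChart I)

theorem exists_chartPoint_eq_maximalMinors (hn : 1 ≤ n) (I : PluckerIndex n r) :
    ∃ A : Matrix (Fin n) (Fin n) (MvPolynomial (ChartIndex I) ℂ), A.det = X none ∧
      chartPoint I = maximalMinors (A * genericChart I) := by
  obtain ⟨A, hA⟩ := exists_det_eq hn (X none : MvPolynomial (ChartIndex I) ℂ)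
  exact ⟨A, hA, by rw [maximalMinors_mul, hA, chartPoint]⟩

theorem chartPoint_self (I : PluckerIndex n r) : chartPoint I I = X none := by
  rw [chartPoint, Pi.smul_apply, maximalMinors, genericChart_submatrix, Matrix.det_one,
    smul_eq_mul, mul_one]

theorem chartMatrix_chartPoint (hn : 1 ≤ n) (I : PluckerIndex n r) :
    chartMatrix (chartPoint I) I = (X none : MvPolynomial (ChartIndex I) ℂ) • genericChart I := by
  obtain ⟨A, hA, h⟩ := exists_chartPoint_eq_maximalMinors hn I
  have h1 : (A * genericChart I).submatrix id I.emb = A * (genericChart I).submatrix id I.emb := rfl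
  rw [h, chartMatrix_maximalMinors, h1, genericChart_submatrix, Matrix.mul_one,
    ← Matrix.mul_assoc, Matrix.adjugate_mul, hA, Matrix.smul_mul, Matrix.one_mul]

/-- The parametrization of the chart, on coordinate rings. -/
noncomputable def chartHom (I : PluckerIndex n r) :
    MvPolynomial (PluckerIndex n r) ℂ →ₐ[ℂ] MvPolynomial (ChartIndex I) ℂ :=
  aeval (chartPoint I)

/-- `chartHom I` becomes surjective once `X none` is inverted: brackets with one exchanged column
map to `X none` times the chart entries. -/
theorem exists_pow_mul_mem_range (hn : 1 ≤ n) (I : PluckerIndex n r)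
    (b : MvPolynomial (ChartIndex I) ℂ) : ∃ m : ℕ, ∃ a, chartHom I a = X none ^ m * b := by
  have ht : chartHom I (X I) = X none := by rw [chartHom, aeval_X, chartPoint_self]
  have hx : ∀ x : ChartIndex I, ∃ a, chartHom I a = X none * X x := by
    rintro (_ | ⟨i, j, hj⟩)
    · exact ⟨X I * X I, by rw [map_mul, ht]⟩
    · refine ⟨bracket X (Function.update I.emb i j), ?_⟩
      have h1 : chartHom I (bracket X (Function.update I.emb i j)) =
          bracket (fun J => chartHom I (X J)) (Function.update I.emb i j) :=
        map_bracket (chartHom I).toRingHom X _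
      have h2 := congrFun (congrFun (chartMatrix_chartPoint hn I) i) j
      rw [h1]
      simp only [chartHom, aeval_X]
      refine Eq.trans h2 ?_
      simp [genericChart, hj]
  induction b using MvPolynomial.induction_on with
  | C c =>
    refine ⟨0, C c, ?_⟩
    rw [← algebraMap_eq, AlgHom.commutes, algebraMap_eq, pow_zero, one_mul]
  | add f g hf hg =>
    obtain ⟨m₁, a₁, h₁⟩ := hf
    obtain ⟨m₂, a₂, h₂⟩ := hg
    refine ⟨m₁ + m₂, X I ^ m₂ * a₁ + X I ^ m₁ * a₂, ?_⟩
    rw [map_add, map_mul, map_mul, map_pow, map_pow, ht, h₁, h₂]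
    ring
  | mul_X f x hf =>
    obtain ⟨m, a, h⟩ := hf
    obtain ⟨a', h'⟩ := hx x
    refine ⟨m + 1, a * a', ?_⟩
    rw [map_mul, h, h']
    ring

/-- The equations of the Plücker image of the funtf variety, in the chart. -/
noncomputable def chartEquation (I : PluckerIndex n r) (i : Fin r) :
    MvPolynomial (ChartIndex I) ℂ :=
  squareSum (chartPoint I) i - C (((r : ℂ) / n) ^ (n - 1))

theorem aeval_chartEquation (I : PluckerIndex n r) (z : ChartIndex I → ℂ) (i : Fin r) :
    aeval z (chartEquation I i) =
      squareSum (fun J => aeval z (chartPoint I J)) i - ((r : ℂ) / n) ^ (n - 1) := by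
  rw [chartEquation, map_sub, aeval_C]
  congr 1
  exact map_squareSum (aeval (R := ℂ) z).toRingHom (chartPoint I) i

theorem aeval_chartPoint_mem (hn : 1 ≤ n) (hr : n ≤ r) (I : PluckerIndex n r)
    (z : ChartIndex I → ℂ) (hz : ∀ i, aeval z (chartEquation I i) = 0) :
    (fun J => aeval z (chartPoint I J)) ∈ funtfPluckerImage n r := by
  rw [mem_funtfPluckerImage_iff_equations hn hr]
  constructor
  · intro J J'
    obtain ⟨A, -, h⟩ := exists_chartPoint_eq_maximalMinors hn I
    have h1 := map_pluckerRelation (aeval (R := ℂ) z).toRingHom (chartPoint I) J J'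
    rw [h, pluckerRelation_maximalMinors, map_zero, ← h] at h1
    exact h1.symm
  · intro i
    have := hz i
    rw [aeval_chartEquation, sub_eq_zero] at this
    exact this

/-- Nullstellensatz: zeros of the chart equations parametrize points of the image, where `f`
vanishes. -/
theorem chartHom_mem_radical (hn : 1 ≤ n) (hr : n ≤ r) (I : PluckerIndex n r)
    {f : MvPolynomial (PluckerIndex n r) ℂ}
    (hf : f ∈ vanishingIdeal ℂ (funtfPluckerImage n r)) :
    chartHom I f ∈ (Ideal.span (Set.range (chartEquation I))).radical := by
  rw [← vanishingIdeal_zeroLocus_eq_radical (K := ℂ), zeroLocus_span]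
  intro z hz
  have h := hf _ (aeval_chartPoint_mem hn hr I z fun i => hz _ ⟨i, rfl⟩)
  rw [← h, chartHom, ← AlgHom.comp_apply, comp_aeval]

/-- All chart coordinates are multiples of `X none`, so modulo it an equation reduces to a nonzero
constant. -/
theorem X_none_notMem (hn : 1 ≤ n) (hr : n ≤ r) (I : PluckerIndex n r)
    (Q : Ideal (MvPolynomial (ChartIndex I) ℂ)) (hQ : Q ≠ ⊤)
    (h : ∀ i, chartEquation I i ∈ Q) : (X none : MvPolynomial (ChartIndex I) ℂ) ∉ Q := by
  intro ht
  have h1 : squareSum (chartPoint I) ⟨0, by omega⟩ ∈ Q := by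
    refine Ideal.sum_mem _ fun J _ => ?_
    rw [sq]
    exact Ideal.mul_mem_left _ _ (Ideal.mul_mem_right _ _ ht)
  have h2 := Ideal.sub_mem _ h1 (h ⟨0, by omega⟩)
  rw [chartEquation, sub_sub_cancel] at h2
  refine hQ (Ideal.eq_top_of_isUnit_mem _ h2 (IsUnit.map C (IsUnit.mk0 _ ?_)))
  exact pow_ne_zero _ (frame_bound_ne_zero hn hr)

/-- Contraction along `chartHom I` preserves strict inclusions, because the primes concerned avoid
`X none` and the map is surjective up to powers of it. -/
theorem ringKrullDim_chart_le (hn : 1 ≤ n) (hr : n ≤ r) (I : PluckerIndex n r) :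
    ringKrullDim (MvPolynomial (ChartIndex I) ℂ ⧸ Ideal.span (Set.range (chartEquation I))) ≤
      affineDim (funtfPluckerImage n r) := by
  rw [affineDim, ringKrullDim_quotient, ringKrullDim_quotient]
  have hmem : ∀ Q : PrimeSpectrum.zeroLocus
      (Ideal.span (Set.range (chartEquation I)) : Set (MvPolynomial (ChartIndex I) ℂ)),
      PrimeSpectrum.comap (chartHom I).toRingHom Q.1 ∈ PrimeSpectrum.zeroLocus
        (vanishingIdeal ℂ (funtfPluckerImage n r) : Set (MvPolynomial (PluckerIndex n r) ℂ)) := by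
    intro Q f hf
    exact (Q.1.isPrime.radical_le_iff.2 Q.2) (chartHom_mem_radical hn hr I hf)
  refine Order.krullDim_le_of_strictMono (fun Q => ⟨_, hmem Q⟩) ?_
  intro Q Q' hlt
  refine lt_of_le_not_ge (fun a ha => hlt.le ha) fun hle => hlt.not_ge fun b hb => ?_
  obtain ⟨m, a, ha⟩ := exists_pow_mul_mem_range hn I b
  have h1 : chartHom I a ∈ Q'.1.asIdeal := by rw [ha]; exact Ideal.mul_mem_left _ _ hb
  have h2 : chartHom I a ∈ Q.1.asIdeal := hle h1
  rw [ha] at h2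
  refine (Q.1.isPrime.mem_or_mem h2).resolve_left fun h3 => ?_
  exact X_none_notMem hn hr I Q.1.asIdeal Q.1.isPrime.ne_top
    (fun i => Q.2 (Ideal.subset_span ⟨i, rfl⟩)) (Q.1.isPrime.mem_of_pow_mem _ h3)

theorem exists_chart_zero (hn : 1 ≤ n) (hr : n ≤ r) :
    ∃ (I : PluckerIndex n r) (z : ChartIndex I → ℂ), ∀ i, aeval z (chartEquation I i) = 0 := by
  obtain ⟨V, hV⟩ := funtf_complex_nonempty hn hr
  obtain ⟨I, hI⟩ := exists_maximalMinors_ne_zero hn hr hV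
  set U := V.submatrix id I.emb with hU
  have hUu : IsUnit U.det := IsUnit.mk0 _ hI
  -- `U⁻¹ * V` has the identity block required by the chart; the coordinate `U.det` restores the
  -- scale of the minors.
  let z : ChartIndex I → ℂ := fun x => x.elim U.det fun y => (U⁻¹ * V) y.1 y.2
  have hmap : (genericChart I).map (aeval z) = U⁻¹ * V := by
    ext i j
    rw [Matrix.map_apply, genericChart, Matrix.of_apply]
    split_ifs with h h'
    · subst h'
      have : (U⁻¹ * V) i (I.emb i) = (U⁻¹ * U) i i := rfl
      rw [this, Matrix.nonsing_inv_mul _ hUu, map_one, Matrix.one_apply_eq]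
    · obtain ⟨b, rfl⟩ := I.exists_emb_eq h
      have : (U⁻¹ * V) i (I.emb b) = (U⁻¹ * U) i b := rfl
      rw [this, Matrix.nonsing_inv_mul _ hUu, map_zero, Matrix.one_apply_ne]
      exact fun hib => h' (congrArg _ hib)
    · rw [aeval_X]; rfl
  have hpt : (fun J => aeval z (chartPoint I J)) = maximalMinors V := by
    funext J
    have h1 : aeval z (maximalMinors (genericChart I) J) = maximalMinors (U⁻¹ * V) J := by
      rw [← hmap]
      exact map_maximalMinors (aeval (R := ℂ) z).toRingHom (genericChart I) J
    rw [chartPoint, Pi.smul_apply, smul_eq_mul, map_mul, aeval_X, h1, maximalMinors_mul,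
      Pi.smul_apply, smul_eq_mul, ← mul_assoc, Matrix.det_nonsing_inv]
    change U.det * _ * _ = _
    rw [Ring.mul_inverse_cancel _ hUu, one_mul]
  refine ⟨I, z, fun i => ?_⟩
  rw [aeval_chartEquation, hpt, squareSum_of_mem_funtf hn hr hV, sub_self]

theorem natCard_chartIndex (I : PluckerIndex n r) : Nat.card (ChartIndex I) = n * (r - n) + 1 := by
  rw [Nat.card_eq_fintype_card, Fintype.card_option, Fintype.card_prod, Fintype.card_fin,
    Fintype.card_subtype_compl, Fintype.card_fin, Fintype.card_coe, I.2]

/-- Krull's height theorem at a zero of the chart equations: `r` equations lower the dimension by at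
most `r`. -/
theorem le_affineDim_funtfPluckerImage (hn : 1 ≤ n) (hr : n ≤ r) :
    ((n * (r - n) + 1 : ℕ) : WithBot ℕ∞) ≤ affineDim (funtfPluckerImage n r) + (r : ℕ) := by
  obtain ⟨I, z, hz⟩ := exists_chart_zero hn hr
  have h1 := Ideal.height_le_ringKrullDim_quotient_add_encard (p := vanishingIdeal ℂ {z})
    (Set.range (chartEquation I)) (by
      rintro _ ⟨i, rfl⟩
      exact (mem_vanishingIdeal_singleton_iff z _).2 (hz i))
  rw [height_vanishingIdeal_singleton, natCard_chartIndex] at h1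
  have h2 : (Set.range (chartEquation I)).encard ≤ r := by
    rw [← Set.image_univ]
    refine (Set.encard_image_le _ _).trans ?_
    rw [Set.encard_univ, ENat.card_eq_coe_fintype_card, Fintype.card_fin]
  refine le_trans (le_trans (by norm_cast) h1) ?_
  exact add_le_add (ringKrullDim_chart_le hn hr I) (WithBot.coe_le_coe.2 h2)

theorem affineDim_funtfPluckerImage (hn : 1 ≤ n) (hr : n < r) :
    affineDim (funtfPluckerImage n r) =
      (((((r : ℤ) - n) * n - r + 1).toNat : ℕ) : WithBot ℕ∞) := by
  have h1 := affineDim_funtfPluckerImage_le hn hr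
  have h2 := le_affineDim_funtfPluckerImage hn hr.le
  -- The integer equals `(n-1)(r-n-1) ≥ 0` when `n < r`, so `toNat` loses nothing.
  have h3 : n * (r - n) + 1 = (((r : ℤ) - n) * n - r + 1).toNat + r := by
    obtain ⟨m, rfl⟩ : ∃ m, n = m + 1 := ⟨n - 1, by omega⟩
    obtain ⟨l, rfl⟩ : ∃ l, r = m + 1 + (l + 1) := ⟨r - (m + 1) - 1, by omega⟩
    have h4 : (((m + 1 + (l + 1) : ℕ) : ℤ) - (m + 1 : ℕ)) * (m + 1 : ℕ) -
        (m + 1 + (l + 1) : ℕ) + 1 = (l * m : ℕ) := by push_cast; ring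
    rw [h4, Int.toNat_natCast, Nat.add_sub_cancel_left]
    ring
  rw [h3] at h2
  refine le_antisymm h1 ?_
  generalize (((r : ℤ) - n) * n - r + 1).toNat = d at *
  generalize affineDim (funtfPluckerImage n r) = D at *
  induction D using WithBot.recBotCoe with
  | bot => simp at h2
  | coe D =>
    induction D using ENat.recTopCoe with
    | top => exact le_top
    | coe D => norm_cast at h2 ⊢; omega

end Chart

theorem mainTheorem5 (n r : ℕ) (hn : 1 ≤ n) (hr : n ≤ r) :
    IsAffineVariety (funtfPluckerImage n r) ∧
    (n < r → ∃ d : ℕ, affineDim (funtfPluckerImage n r) = (d : WithBot ℕ∞) ∧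
      (d : ℤ) = ((r : ℤ) - (n : ℤ)) * (n : ℤ) - (r : ℤ) + 1) ∧
    funtfPluckerImage n r =
      {p | p ∈ grassmannCone n r ∧
        ∀ i : Fin r, ∑ I : PluckerIndex n r with i ∈ I.1, p I ^ 2 =
          ((r : ℂ) / (n : ℂ)) ^ (n - 1)} ∧
    ∃ e : FuntfOrbit n r ≃ realPoints (funtfPluckerImage n r),
      ∀ V : funtf ℝ n r,
        (e (Quotient.mk (rotationSetoid n r) V) : PluckerIndex n r → ℝ) = pluckerMap V.1 := by
  refine ⟨isAffineVariety_funtfPluckerImage hn hr, fun hlt => ⟨_,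
    affineDim_funtfPluckerImage hn hlt, Int.toNat_of_nonneg ?_⟩,
    Set.ext (mem_funtfPluckerImage_iff hn hr), exists_equiv_realPoints hn hr⟩
  have h1 : (1 : ℤ) ≤ n := by exact_mod_cast hn
  have h2 : (n : ℤ) + 1 ≤ r := by exact_mod_cast hlt
  nlinarith
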